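/- Let $n\ge 2$ and let $\Omega\subset\mathbb{R}^n$ be a bounded domain with $C^3$ boundary and outward unit normal $\vec{\mathbf n}$ on $\partial\Omega$. Let $\alpha\in(0,1)$, $q>0$, $\phi\in C^3(\overline\Omega)$, $u_0\in C^{2,\alpha}(\overline\Omega)$, and let $c=c(x,z)$ and $f=f(x,z)$ be functions of class $C^{1,\alpha}$ on $\overline\Omega\times\mathbb{R}$ such that, for some constant $C$, $$|c|\le C,\quad |D_xc|\le C,\quad c_z\le 0,\qquad |f|\le C,\quad |D_xf|\le C,\quad f_z\ge 0\qquad\text{on }\overline\Omega\times\mathbb{R}.$$ Then for every $T\in(0,\infty)$ there is a constant $R_T>1$, depending only on $T,\Omega,c,f,\phi,q,u_0$ (in particular not on $\eta$), with the following property. Let $\eta\in(0,1]$, $\sigma\in(0,1)$, and let $u^\eta=u\in C^{2,\sigma}(\overline\Omega\times[0,T])\cap C^{3,\sigma}(\Omega\times(0,T])$ (parabolic Hölder classes: $u,Du,D^2u,u_t$ are continuous on $\overline\Omega\times[0,T]$ with $D^2u,u_t$ being $\sigma$-Hölder for the parabolic distance $|x-y|+|t-s|^{1/2}$, and $D^3u,Du_t$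 are continuous on $\Omega\times(0,T]$ and $\sigma$-Hölder for this distance on its compact subsets) be a solution of $$\begin{cases}u_t=v\,\mathrm{div}\!\left(\dfrac{Du}{v}\right)+c(x,u)\,v-f(x,u)&\text{in }\Omega\times(0,T),\\[4pt]\dfrac{\partial u}{\partial\vec{\mathbf n}}=\phi(x)\,v^{1-q}&\text{on }\partial\Omega\times[0,T),\\[4pt]u(x,0)=u_0(x)&\text{on }\overline\Omega,\end{cases}\qquad v:=\sqrt{\eta^2+|Du|^2}.$$ Then $$\|Du^\eta\|_{L^\infty(\overline\Omega\times[0,T])}\le R_T .$$ -/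

import Mathlib

open Set Filter Topology

noncomputable section

namespace CapillaryFlow

/-- `g` is a defining function of class `C^k` of the open set `Ω` on the open set `U`:
`Ω ∩ U = {g < 0}` and `Dg ≠ 0` on `U`.  (Then `∂Ω ∩ U = {g = 0}`.) -/
structure IsDefiningFunction {n : ℕ} (k : ℕ) (Ω U : Set (EuclideanSpace ℝ (Fin n)))
    (g : EuclideanSpace ℝ (Fin n) → ℝ) : Prop where
  isOpen : IsOpen U
  contDiffOn : ContDiffOn ℝ k g U
  gradient_ne_zero : ∀ y ∈ U, gradient g y ≠ 0
  inter_eq : Ω ∩ U = {y ∈ U | g y < 0}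

/-- A bounded domain (nonempty, open, connected) of `ℝⁿ` with boundary of class `C^k`. -/
structure IsBoundedDomainOfClass {n : ℕ} (k : ℕ) (Ω : Set (EuclideanSpace ℝ (Fin n))) :
    Prop where
  isOpen : IsOpen Ω
  isConnected : IsConnected Ω
  isBounded : Bornology.IsBounded Ω
  boundary : ∀ x ∈ frontier Ω, ∃ U g, x ∈ U ∧ IsDefiningFunction k Ω U g

/-- `ν` is the outward unit normal vector to `∂Ω` at the boundary point `x`: the normalized
gradient of a defining function near `x`.  (It does not depend on the defining function.) -/
def IsOutwardUnitNormal {n : ℕ} (Ω : Set (EuclideanSpace ℝ (Fin n)))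
    (x ν : EuclideanSpace ℝ (Fin n)) : Prop :=
  x ∈ frontier Ω ∧ ∃ U g, x ∈ U ∧ IsDefiningFunction 1 Ω U g ∧
    ν = ‖gradient g x‖⁻¹ • gradient g x

/-- The class `C^{k,α}(s)`: `g` is `C^k` on `s` and its derivative of order `k` is
`α`-Hölder continuous on the compact subsets of `s` (hence on `s` if `s` is compact). -/
def IsOfClassHolder {F : Type*} [NormedAddCommGroup F] [NormedSpace ℝ F] (k : ℕ) (α : ℝ)
    (s : Set F) (g : F → ℝ) : Prop :=
  ContDiffOn ℝ k g s ∧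
    ∀ K ⊆ s, IsCompact K → ∃ C : ℝ, ∀ x ∈ K, ∀ y ∈ K,
      ‖iteratedFDerivWithin ℝ k g s x - iteratedFDerivWithin ℝ k g s y‖ ≤ C * dist x y ^ α

/-- Assumptions on the forcing term: `c ∈ C^{1,α}(Ω̄ × ℝ)`, `|c| ≤ C`, `|D_x c| ≤ C` and
`c_z ≤ 0` on `Ω̄ × ℝ`. -/
def ForcingAssumption {n : ℕ} (α : ℝ) (Ω : Set (EuclideanSpace ℝ (Fin n)))
    (c : EuclideanSpace ℝ (Fin n) → ℝ → ℝ) : Prop :=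
  IsOfClassHolder 1 α (closure Ω ×ˢ (univ : Set ℝ)) (fun p => c p.1 p.2) ∧
    ∃ C : ℝ, ∀ x ∈ closure Ω, ∀ z : ℝ,
      |c x z| ≤ C ∧ ‖gradientWithin (fun y => c y z) (closure Ω) x‖ ≤ C ∧
        deriv (fun s => c x s) z ≤ 0

/-- Assumptions on the transport term: `f ∈ C^{1,α}(Ω̄ × ℝ)`, `|f| ≤ C`, `|D_x f| ≤ C` and
`f_z ≥ 0` on `Ω̄ × ℝ`. -/
def TransportAssumption {n : ℕ} (α : ℝ) (Ω : Set (EuclideanSpace ℝ (Fin n)))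
    (f : EuclideanSpace ℝ (Fin n) → ℝ → ℝ) : Prop :=
  IsOfClassHolder 1 α (closure Ω ×ˢ (univ : Set ℝ)) (fun p => f p.1 p.2) ∧
    ∃ C : ℝ, ∀ x ∈ closure Ω, ∀ z : ℝ,
      |f x z| ≤ C ∧ ‖gradientWithin (fun y => f y z) (closure Ω) x‖ ≤ C ∧
        0 ≤ deriv (fun s => f x s) z

/-- The spatial gradient `Du(x,t)`, for `x ∈ Ω̄` (up to the boundary). -/
def spaceGrad {n : ℕ} (Ω : Set (EuclideanSpace ℝ (Fin n)))
    (u : EuclideanSpace ℝ (Fin n) → ℝ → ℝ) (x : EuclideanSpace ℝ (Fin n)) (t : ℝ) :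
    EuclideanSpace ℝ (Fin n) :=
  gradientWithin (fun y => u y t) (closure Ω) x

/-- The time derivative `u_t(x,t)`, for `t ∈ [0,T]` (one-sided at the end points). -/
def timeDeriv {n : ℕ} (T : ℝ) (u : EuclideanSpace ℝ (Fin n) → ℝ → ℝ)
    (x : EuclideanSpace ℝ (Fin n)) (t : ℝ) : ℝ :=
  derivWithin (fun s => u x s) (Icc 0 T) t

/-- Divergence of a vector field on `ℝⁿ`. -/
def divergence {n : ℕ} (F : EuclideanSpace ℝ (Fin n) → EuclideanSpace ℝ (Fin n))
    (x : EuclideanSpace ℝ (Fin n)) : ℝ :=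
  ∑ i : Fin n, fderiv ℝ F x (EuclideanSpace.single i 1) i

/-- `G` is `σ`-Hölder continuous on `K` for the parabolic distance `|x - y| + |t - s|^{1/2}`. -/
def ParabolicHolderOn {n : ℕ} {V : Type*} [NormedAddCommGroup V] (σ : ℝ)
    (K : Set (EuclideanSpace ℝ (Fin n) × ℝ)) (G : EuclideanSpace ℝ (Fin n) → ℝ → V) : Prop :=
  ∃ C : ℝ, ∀ p ∈ K, ∀ r ∈ K,
    ‖G p.1 p.2 - G r.1 r.2‖ ≤ C * (dist p.1 r.1 + √|p.2 - r.2|) ^ σ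

/-- The parabolic Hölder class `C^{2,σ}(Ω̄ × [0,T])`: `u`, `Du`, `D²u`, `u_t` exist and are
continuous on `Ω̄ × [0,T]`, and `D²u`, `u_t` are `σ`-Hölder for the parabolic distance. -/
structure IsParabolicC2 {n : ℕ} (σ : ℝ) (Ω : Set (EuclideanSpace ℝ (Fin n))) (T : ℝ)
    (u : EuclideanSpace ℝ (Fin n) → ℝ → ℝ) : Prop where
  space : ∀ t ∈ Icc 0 T, ContDiffOn ℝ 2 (fun y => u y t) (closure Ω)
  time : ∀ x ∈ closure Ω, DifferentiableOn ℝ (fun s => u x s) (Icc 0 T)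
  continuousOn : ContinuousOn (fun p : EuclideanSpace ℝ (Fin n) × ℝ => u p.1 p.2)
    (closure Ω ×ˢ Icc 0 T)
  continuousOn_grad : ContinuousOn
    (fun p : EuclideanSpace ℝ (Fin n) × ℝ => spaceGrad Ω u p.1 p.2) (closure Ω ×ˢ Icc 0 T)
  continuousOn_hess : ContinuousOn
    (fun p : EuclideanSpace ℝ (Fin n) × ℝ =>
      iteratedFDerivWithin ℝ 2 (fun y => u y p.2) (closure Ω) p.1) (closure Ω ×ˢ Icc 0 T)
  continuousOn_timeDeriv : ContinuousOn
    (fun p : EuclideanSpace ℝ (Fin n) × ℝ => timeDeriv T u p.1 p.2) (closure Ω ×ˢ Icc 0 T)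
  holder_hess : ParabolicHolderOn σ (closure Ω ×ˢ Icc 0 T)
    (fun x t => iteratedFDerivWithin ℝ 2 (fun y => u y t) (closure Ω) x)
  holder_timeDeriv : ParabolicHolderOn σ (closure Ω ×ˢ Icc 0 T) (timeDeriv T u)

/-- The additional interior regularity `C^{3,σ}(Ω × (0,T])` in the parabolic sense: `D³u` and
`Du_t` exist and are continuous on `Ω × (0,T]`, and are `σ`-Hölder for the parabolic distance on
the compact subsets of `Ω × (0,T]`. -/
structure IsParabolicC3Interior {n : ℕ} (σ : ℝ) (Ω : Set (EuclideanSpace ℝ (Fin n))) (T : ℝ)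
    (u : EuclideanSpace ℝ (Fin n) → ℝ → ℝ) : Prop where
  space : ∀ t ∈ Ioc 0 T, ContDiffOn ℝ 3 (fun y => u y t) Ω
  timeDeriv_space : ∀ t ∈ Ioc 0 T, DifferentiableOn ℝ (fun y => timeDeriv T u y t) Ω
  continuousOn_third : ContinuousOn
    (fun p : EuclideanSpace ℝ (Fin n) × ℝ => iteratedFDeriv ℝ 3 (fun y => u y p.2) p.1)
    (Ω ×ˢ Ioc 0 T)
  continuousOn_grad_timeDeriv : ContinuousOn
    (fun p : EuclideanSpace ℝ (Fin n) × ℝ => gradient (fun y => timeDeriv T u y p.2) p.1)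
    (Ω ×ˢ Ioc 0 T)
  holder_third : ∀ K ⊆ Ω ×ˢ Ioc 0 T, IsCompact K →
    ParabolicHolderOn σ K (fun x t => iteratedFDeriv ℝ 3 (fun y => u y t) x)
  holder_grad_timeDeriv : ∀ K ⊆ Ω ×ˢ Ioc 0 T, IsCompact K →
    ParabolicHolderOn σ K (fun x t => gradient (fun y => timeDeriv T u y t) x)

/-- `v = √(η² + |Du|²)`. -/
def area {n : ℕ} (η : ℝ) (Ω : Set (EuclideanSpace ℝ (Fin n)))
    (u : EuclideanSpace ℝ (Fin n) → ℝ → ℝ) (x : EuclideanSpace ℝ (Fin n)) (t : ℝ) : ℝ :=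
  √(η ^ 2 + ‖spaceGrad Ω u x t‖ ^ 2)

/-- `u` solves, in the classical sense,
`u_t = v div (Du / v) + c(x,u) v - f(x,u)` in `Ω × (0,T)`,
`∂u/∂n = φ v^{1-q}` on `∂Ω × [0,T)`, `u(·,0) = u₀` on `Ω̄`, where `v = √(η² + |Du|²)`. -/
structure IsSolution {n : ℕ} (η q : ℝ) (Ω : Set (EuclideanSpace ℝ (Fin n))) (T : ℝ)
    (c f : EuclideanSpace ℝ (Fin n) → ℝ → ℝ) (φ u₀ : EuclideanSpace ℝ (Fin n) → ℝ)
    (u : EuclideanSpace ℝ (Fin n) → ℝ → ℝ) : Prop where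
  equation : ∀ x ∈ Ω, ∀ t ∈ Ioo 0 T,
    timeDeriv T u x t =
      area η Ω u x t * divergence (fun y => (area η Ω u y t)⁻¹ • spaceGrad Ω u y t) x
        + c x (u x t) * area η Ω u x t - f x (u x t)
  boundary : ∀ x ∈ frontier Ω, ∀ ν, IsOutwardUnitNormal Ω x ν → ∀ t ∈ Ico 0 T,
    inner ℝ (spaceGrad Ω u x t) ν = φ x * area η Ω u x t ^ (1 - q)
  initial : ∀ x ∈ closure Ω, u x 0 = u₀ x

end CapillaryFlow

end

/-! The proof is a maximum principle for `auxiliary`, Φ = ½ log(η² + |P|²) + K h − M t, where P = Du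
− v^{1-q} φ Y is the corrected gradient. Here Y is a C² extension of the outward normal, and h = −ρ,
where Dρ is at least δ times the normal on ∂Ω. The boundary condition says exactly that P is
tangential on ∂Ω. Since v^{1-q} = v · v^{-q} and q > 0, the correction is negligible relative to v
once v exceeds a threshold v₀ independent of η (`Large`). In that regime |P| and v are comparable,
and bounding Φ bounds Du.

At a boundary maximum (`multiplier_le`, `boundary_max_bound`), Φ is stationary in the tangential
direction P. Differentiating P · Y = 0 along ∂Ω in the same direction determines the normal
component of D²u P. With the sign of the normal derivative of Φ this gives Kδ ≤ 3 + 18B, where B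
bounds φY, Y and their derivatives. A larger K excludes such maxima.

At an interior maximum (`deriv_source_le`, `interior_max_bound`), the equation is differentiated in
the direction ξ = D_p(½ log(η² + |P|²)). The matrix I − p ⊗ p / v² is written as a sum of squares of
frame vectors ω (`sum_frame`). The second-order condition along each ω bounds the third derivatives
of u and leaves a good term |D²u ω|²/(8v²), which absorbs the terms from differentiating the matrix.
The signs of c_z and f_z, together with ξ · Du ≥ 0, discard the terms without a bound. Hence M ≤
`interiorConst`, and a larger M excludes these maxima.

What remains is t = 0, where Du is that of u₀, or v = v₀ (`norm_spaceGrad_le_of_no_max`). None of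
the constants involves η. -/

noncomputable section

namespace CapillaryFlow

/-! ### Conditions at a maximum on a line, and derivatives of the corrected gradient. -/

section

theorem second_deriv_nonpos_of_isLocalMax {w w₁ : ℝ → ℝ} {w₂ a : ℝ} (hmax : IsLocalMax w a)
    (h₁ : ∀ᶠ s in 𝓝 a, HasDerivAt w (w₁ s) s) (h₂ : HasDerivAt w₁ w₂ a) :
    w₁ a = 0 ∧ w₂ ≤ 0 := by
  have h0 : w₁ a = 0 := hmax.hasDerivAt_eq_zero h₁.self_of_nhds
  refine ⟨h0, ?_⟩
  by_contra! hpos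
  have hd : deriv w =ᶠ[𝓝 a] w₁ := h₁.mono fun s hs => hs.deriv
  have hdd : deriv (deriv w) a = w₂ := by rw [hd.deriv_eq]; exact h₂.deriv
  -- A positive second derivative would make the point a local minimum too, so `w` would be locally
  -- constant and its second derivative zero.
  have hmin : IsLocalMin w a :=
    isLocalMin_of_deriv_deriv_pos (by rw [hdd]; exact hpos)
      (by rw [hd.self_of_nhds, h0]) h₁.self_of_nhds.continuousAt
  have hconst : w =ᶠ[𝓝 a] fun _ => w a := by
    filter_upwards [hmax, hmin] with s h1 h2 using le_antisymm h1 h2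
  have : deriv w =ᶠ[𝓝 a] fun _ => 0 := by
    filter_upwards [hconst.eventuallyEq_nhds] with s hs
    rw [hs.deriv_eq]; simp
  rw [this.deriv_eq] at hdd
  simp at hdd
  linarith

variable {V : Type*} [NormedAddCommGroup V] [InnerProductSpace ℝ V]

theorem hasDerivAt_sqrt_add_norm_sq {η : ℝ} (hη : 0 < η) {p : ℝ → V} {p' : V} {s : ℝ}
    (hp : HasDerivAt p p' s) :
    HasDerivAt (fun r => √(η ^ 2 + ‖p r‖ ^ 2))
      (inner ℝ (p s) p' / √(η ^ 2 + ‖p s‖ ^ 2)) s := by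
  have h := (hp.norm_sq.const_add (η ^ 2)).sqrt (by positivity)
  convert h using 1
  rw [mul_div_mul_left _ _ two_ne_zero]

theorem hasDerivAt_half_log {η : ℝ} (hη : 0 < η) {P : ℝ → V} {P' : V} {s : ℝ}
    (hP : HasDerivAt P P' s) :
    HasDerivAt (fun r => Real.log (η ^ 2 + ‖P r‖ ^ 2) / 2)
      (inner ℝ (P s) P' / (η ^ 2 + ‖P s‖ ^ 2)) s := by
  have h := ((hP.norm_sq.const_add (η ^ 2)).log (by positivity)).div_const 2
  refine h.congr_deriv ?_
  ring

/-- First and second order conditions at a maximum of `½ log (η² + |P|²) + K h` along a line. -/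
theorem half_log_max_conditions {η : ℝ} (hη : 0 < η) {P P₁ : ℝ → V} {P₂ : V} {h h₁ : ℝ → ℝ}
    {h₂ K : ℝ} (hP : ∀ᶠ s in 𝓝 0, HasDerivAt P (P₁ s) s) (hP₁ : HasDerivAt P₁ P₂ 0)
    (hh : ∀ᶠ s in 𝓝 0, HasDerivAt h (h₁ s) s) (hh₁ : HasDerivAt h₁ h₂ 0)
    (hmax : IsLocalMax (fun s => Real.log (η ^ 2 + ‖P s‖ ^ 2) / 2 + K * h s) 0) :
    inner ℝ (P 0) (P₁ 0) / (η ^ 2 + ‖P 0‖ ^ 2) + K * h₁ 0 = 0 ∧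
      (‖P₁ 0‖ ^ 2 + inner ℝ (P 0) P₂) / (η ^ 2 + ‖P 0‖ ^ 2) - 2 * (K * h₁ 0) ^ 2 + K * h₂ ≤ 0 := by
  have hE : 0 < η ^ 2 + ‖P 0‖ ^ 2 := by positivity
  have e1 : ∀ᶠ s in 𝓝 (0 : ℝ), HasDerivAt
      (fun s => Real.log (η ^ 2 + ‖P s‖ ^ 2) / 2 + K * h s)
      (inner ℝ (P s) (P₁ s) / (η ^ 2 + ‖P s‖ ^ 2) + K * h₁ s) s := by
    filter_upwards [hP, hh] with s h1 h2
    exact (hasDerivAt_half_log hη h1).add (h2.const_mul K)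
  have hP0 := hP.self_of_nhds
  have e2 := ((hP0.inner ℝ hP₁).div (hP0.norm_sq.const_add (η ^ 2)) hE.ne').add (hh₁.const_mul K)
  obtain ⟨a1, a2⟩ := second_deriv_nonpos_of_isLocalMax hmax e1 e2
  refine ⟨a1, ?_⟩
  -- With E = η² + |P|², the first-order condition turns the term −2 (P · P₁)²/E² of the second
  -- derivative into −2 (K h₁)², which no longer contains derivatives of `P`.
  have a3 : inner ℝ (P 0) (P₁ 0) = - (K * h₁ 0) * (η ^ 2 + ‖P 0‖ ^ 2) := by
    field_simp at a1; linarith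
  refine le_trans (le_of_eq ?_) a2
  rw [real_inner_self_eq_norm_sq, a3]
  field_simp
  ring

/-- The vector `p - v^{1-q} b`, with `v = √(η² + |p|²)`. -/
def corrected (η q : ℝ) (p b : V) : V := p - (√(η ^ 2 + ‖p‖ ^ 2) ^ (1 - q)) • b

/-- The derivative of `corrected` when `p`, `b` have the derivatives `p₁`, `b₁`. -/
def correctedDeriv (η q : ℝ) (p b p₁ b₁ : V) : V :=
  p₁ - ((1 - q) * √(η ^ 2 + ‖p‖ ^ 2) ^ (-q) * (inner ℝ p p₁ / √(η ^ 2 + ‖p‖ ^ 2))) • b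
    - (√(η ^ 2 + ‖p‖ ^ 2) ^ (1 - q)) • b₁

theorem hasDerivAt_corrected {η q : ℝ} (hη : 0 < η) {p b : ℝ → V} {p₁ b₁ : V} {s : ℝ}
    (hp : HasDerivAt p p₁ s) (hb : HasDerivAt b b₁ s) :
    HasDerivAt (fun r => corrected η q (p r) (b r)) (correctedDeriv η q (p s) (b s) p₁ b₁) s := by
  have hv : √(η ^ 2 + ‖p s‖ ^ 2) ≠ 0 := by positivity
  have h1 := (hasDerivAt_sqrt_add_norm_sq hη hp).rpow_const (p := 1 - q) (Or.inl hv)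
  have h2 := hp.sub (h1.smul hb)
  refine h2.congr_deriv ?_
  rw [show 1 - q - 1 = -q by ring]
  simp only [correctedDeriv]
  rw [show inner ℝ (p s) p₁ / √(η ^ 2 + ‖p s‖ ^ 2) * (1 - q) * √(η ^ 2 + ‖p s‖ ^ 2) ^ (-q) =
    (1 - q) * √(η ^ 2 + ‖p s‖ ^ 2) ^ (-q) * (inner ℝ (p s) p₁ / √(η ^ 2 + ‖p s‖ ^ 2)) by ring]
  abel

/-- The second derivative of `corrected`. -/
def correctedDeriv₂ (η q : ℝ) (p b p₁ b₁ p₂ b₂ : V) : V :=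
  p₂ - ((1 - q) * √(η ^ 2 + ‖p‖ ^ 2) ^ (-q) / √(η ^ 2 + ‖p‖ ^ 2) *
      (‖p₁‖ ^ 2 + inner ℝ p p₂ - (1 + q) * (inner ℝ p p₁ / √(η ^ 2 + ‖p‖ ^ 2)) ^ 2)) • b
    - (2 * ((1 - q) * √(η ^ 2 + ‖p‖ ^ 2) ^ (-q) * (inner ℝ p p₁ / √(η ^ 2 + ‖p‖ ^ 2)))) • b₁
    - (√(η ^ 2 + ‖p‖ ^ 2) ^ (1 - q)) • b₂

theorem hasDerivAt_correctedDeriv {η q : ℝ} (hη : 0 < η) {p b p₁ b₁ : ℝ → V} {p₂ b₂ : V} {s : ℝ}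
    (hp : HasDerivAt p (p₁ s) s) (hb : HasDerivAt b (b₁ s) s)
    (hp₁ : HasDerivAt p₁ p₂ s) (hb₁ : HasDerivAt b₁ b₂ s) :
    HasDerivAt (fun r => correctedDeriv η q (p r) (b r) (p₁ r) (b₁ r))
      (correctedDeriv₂ η q (p s) (b s) (p₁ s) (b₁ s) p₂ b₂) s := by
  have hv : √(η ^ 2 + ‖p s‖ ^ 2) ≠ 0 := by positivity
  have hv0 : 0 < √(η ^ 2 + ‖p s‖ ^ 2) := by positivity
  have hV := hasDerivAt_sqrt_add_norm_sq hη hp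
  have h1 := hV.rpow_const (p := 1 - q) (Or.inl hv)
  have h2 := hV.rpow_const (p := -q) (Or.inl hv)
  have h3 := (hp.inner ℝ hp₁).div hV hv
  have h4 := (hp₁.sub ((((h2.const_mul (1 - q)).mul h3)).smul hb)).sub (h1.smul hb₁)
  refine h4.congr_deriv ?_
  simp only [correctedDeriv₂, Pi.mul_apply, Pi.div_apply]
  rw [show 1 - q - 1 = -q by ring, Real.rpow_sub_one hv, real_inner_self_eq_norm_sq]
  generalize √(η ^ 2 + ‖p s‖ ^ 2) = v at *
  generalize v ^ (-q) = θ
  match_scalars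
  · ring
  · field_simp
    ring
  · field_simp
    ring
  · ring

end

/-! ### Estimates for the corrected gradient when the gradient is large. -/

section

section Norms

variable {V : Type*} [NormedAddCommGroup V]

/-- `Large η q B p`: the gradient `p` is so large that the correction by vectors of length at
most `B` is a small relative perturbation. -/
structure Large (η q B : ℝ) (p : V) : Prop where
  pos : 0 < η
  le_one : η ≤ 1
  q_pos : 0 < q
  B_nonneg : 0 ≤ B
  two_le : 2 ≤ √(η ^ 2 + ‖p‖ ^ 2)
  small : 100 * (1 + q) ^ 2 * (√(η ^ 2 + ‖p‖ ^ 2) ^ (-q) * B) ≤ 1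

namespace Large

variable {η q B : ℝ} {p : V}

theorem rpow_eq (h : Large η q B p) :
    √(η ^ 2 + ‖p‖ ^ 2) ^ (1 - q) = √(η ^ 2 + ‖p‖ ^ 2) * √(η ^ 2 + ‖p‖ ^ 2) ^ (-q) := by
  have := h.two_le
  rw [show 1 - q = 1 + -q by ring, Real.rpow_add (by linarith), Real.rpow_one]

theorem sq_eq (_h : Large η q B p) : √(η ^ 2 + ‖p‖ ^ 2) ^ 2 = η ^ 2 + ‖p‖ ^ 2 :=
  Real.sq_sqrt (by positivity)

theorem norm_le (_h : Large η q B p) : ‖p‖ ≤ √(η ^ 2 + ‖p‖ ^ 2) :=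
  Real.le_sqrt_of_sq_le (by nlinarith [sq_nonneg η])

theorem rpow_pos (h : Large η q B p) : 0 < √(η ^ 2 + ‖p‖ ^ 2) ^ (-q) :=
  Real.rpow_pos_of_pos (by linarith [h.two_le]) _

theorem mul_le (h : Large η q B p) : √(η ^ 2 + ‖p‖ ^ 2) ^ (-q) * B ≤ 1 / 100 := by
  have h1 := h.small
  have h2 : 0 ≤ √(η ^ 2 + ‖p‖ ^ 2) ^ (-q) * B := mul_nonneg h.rpow_pos.le h.B_nonneg
  have h3 : 1 ≤ (1 + q) ^ 2 := by nlinarith [h.q_pos]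
  nlinarith

theorem abs_mul_le (h : Large η q B p) :
    |1 - q| * (√(η ^ 2 + ‖p‖ ^ 2) ^ (-q) * B) ≤ 1 / 100 := by
  have h1 := h.small
  have h2 : 0 ≤ √(η ^ 2 + ‖p‖ ^ 2) ^ (-q) * B := mul_nonneg h.rpow_pos.le h.B_nonneg
  have h3 : |1 - q| ≤ (1 + q) ^ 2 := by
    rw [abs_le]; constructor <;> nlinarith [h.q_pos]
  nlinarith

theorem abs_mul_le' (h : Large η q B p) :
    (1 + q) * |1 - q| * (√(η ^ 2 + ‖p‖ ^ 2) ^ (-q) * B) ≤ 1 / 100 := by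
  have h1 := h.small
  have h2 : 0 ≤ √(η ^ 2 + ‖p‖ ^ 2) ^ (-q) * B := mul_nonneg h.rpow_pos.le h.B_nonneg
  have h3 : |1 - q| ≤ 1 + q := by
    rw [abs_le]; constructor <;> nlinarith [h.q_pos]
  have h4 : (1 + q) * |1 - q| ≤ (1 + q) ^ 2 := by nlinarith [h.q_pos]
  nlinarith

end Large

end Norms

variable {V : Type*} [NormedAddCommGroup V] [InnerProductSpace ℝ V]

namespace Large

variable {η q B : ℝ} {p : V}

theorem norm_corrected_sub_le (h : Large η q B p) {b : V} (hb : ‖b‖ ≤ B) :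
    ‖corrected η q p b - p‖ ≤ √(η ^ 2 + ‖p‖ ^ 2) / 100 := by
  have h0 := h.two_le
  have h1 := h.mul_le
  have h2 := h.rpow_pos
  simp only [corrected, sub_sub_cancel_left, norm_neg, norm_smul, h.rpow_eq]
  rw [Real.norm_of_nonneg (by positivity)]
  calc _ ≤ √(η ^ 2 + ‖p‖ ^ 2) * √(η ^ 2 + ‖p‖ ^ 2) ^ (-q) * B := by gcongr
    _ = √(η ^ 2 + ‖p‖ ^ 2) * (√(η ^ 2 + ‖p‖ ^ 2) ^ (-q) * B) := by ring
    _ ≤ √(η ^ 2 + ‖p‖ ^ 2) * (1 / 100) := by gcongr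
    _ = _ := by ring

theorem norm_corrected_le (h : Large η q B p) {b : V} (hb : ‖b‖ ≤ B) :
    ‖corrected η q p b‖ ≤ 2 * √(η ^ 2 + ‖p‖ ^ 2) := by
  have h0 := h.two_le
  have h1 := h.norm_corrected_sub_le hb
  have h2 := norm_le_norm_add_norm_sub' (corrected η q p b) p
  linarith [h.norm_le]

theorem energy_bounds (h : Large η q B p) {b : V} (hb : ‖b‖ ≤ B) :
    √(η ^ 2 + ‖p‖ ^ 2) ^ 2 / 2 ≤ η ^ 2 + ‖corrected η q p b‖ ^ 2 ∧
      η ^ 2 + ‖corrected η q p b‖ ^ 2 ≤ 2 * √(η ^ 2 + ‖p‖ ^ 2) ^ 2 := by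
  have h0 := h.two_le
  have h1 := h.norm_corrected_sub_le hb
  have h2 := norm_le_norm_add_norm_sub' (corrected η q p b) p
  have h3 := norm_le_norm_add_norm_sub' p (corrected η q p b)
  rw [norm_sub_rev] at h3
  have h4 := h.sq_eq
  have h5 := h.norm_le
  have h6 := norm_nonneg p
  have h7 := norm_nonneg (corrected η q p b)
  generalize √(η ^ 2 + ‖p‖ ^ 2) = v at *
  generalize ‖corrected η q p b‖ = P at *
  generalize ‖corrected η q p b - p‖ = d at *
  constructor
  · rcases le_or_gt ‖p‖ (v / 100) with hp | hp
    · have : ‖p‖ ^ 2 ≤ (v / 100) ^ 2 := by gcongr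
      nlinarith [sq_nonneg P]
    · have : (‖p‖ - v / 100) ^ 2 ≤ P ^ 2 := by
        apply pow_le_pow_left₀ <;> linarith
      nlinarith
  · have : P ^ 2 ≤ (‖p‖ + v / 100) ^ 2 := by
      apply pow_le_pow_left₀ <;> linarith
    nlinarith

end Large

/-- The derivative of `½ log (η² + |corrected η q p b|²)` in `p`. -/
def direction (η q : ℝ) (p b : V) : V :=
  (η ^ 2 + ‖corrected η q p b‖ ^ 2)⁻¹ • (corrected η q p b -
    ((1 - q) * √(η ^ 2 + ‖p‖ ^ 2) ^ (-q) / √(η ^ 2 + ‖p‖ ^ 2) *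
      inner ℝ (corrected η q p b) b) • p)

theorem inner_corrected_correctedDeriv (η q : ℝ) (p b p₁ b₁ : V) :
    inner ℝ (corrected η q p b) (correctedDeriv η q p b p₁ b₁) / (η ^ 2 + ‖corrected η q p b‖ ^ 2)
      = inner ℝ (direction η q p b) p₁ - √(η ^ 2 + ‖p‖ ^ 2) ^ (1 - q) *
        inner ℝ (corrected η q p b) b₁ / (η ^ 2 + ‖corrected η q p b‖ ^ 2) := by
  rw [direction, correctedDeriv]
  generalize corrected η q p b = P
  simp only [inner_sub_right, inner_sub_left, inner_smul_left, inner_smul_right]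
  simp
  ring

namespace Large

variable {η q B : ℝ} {p : V}

theorem norm_direction_le (h : Large η q B p) {b : V} (hb : ‖b‖ ≤ B) :
    ‖direction η q p b‖ ≤ 8 / √(η ^ 2 + ‖p‖ ^ 2) := by
  have h0 := h.two_le
  have h1 := h.abs_mul_le
  have h2 := h.rpow_pos
  have h3 := h.norm_corrected_le hb
  have h4 := (h.energy_bounds hb).1
  have h5 := h.norm_le
  have h6 := abs_real_inner_le_norm (corrected η q p b) b
  rw [direction, norm_smul, norm_inv, Real.norm_of_nonneg (by positivity)]
  have hw : ‖((1 - q) * √(η ^ 2 + ‖p‖ ^ 2) ^ (-q) / √(η ^ 2 + ‖p‖ ^ 2) *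
      inner ℝ (corrected η q p b) b) • p‖ ≤ √(η ^ 2 + ‖p‖ ^ 2) := by
    rw [norm_smul, norm_mul, norm_div, norm_mul, Real.norm_of_nonneg h2.le, Real.norm_eq_abs,
      Real.norm_eq_abs, Real.norm_eq_abs, abs_of_pos (show 0 < √(η ^ 2 + ‖p‖ ^ 2) by linarith)]
    generalize √(η ^ 2 + ‖p‖ ^ 2) = v at *
    generalize v ^ (-q) = θ at *
    have hB := h.B_nonneg
    have h7 : |inner ℝ (corrected η q p b) b| ≤ 2 * v * B :=
      h6.trans (mul_le_mul h3 hb (norm_nonneg _) (by linarith))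
    calc _ ≤ |1 - q| * θ / v * (2 * v * B) * v := by gcongr
      _ = 2 * (|1 - q| * (θ * B)) * v := by field_simp
      _ ≤ 2 * (1 / 100) * v := by gcongr
      _ ≤ v := by linarith
  have h8 := (norm_sub_le _ _).trans (add_le_add h3 hw)
  generalize √(η ^ 2 + ‖p‖ ^ 2) = v at *
  calc _ ≤ (v ^ 2 / 2)⁻¹ * (2 * v + v) := by
        have : 0 < v := by linarith
        gcongr
    _ ≤ 8 / v := by
        have : 0 < v := by linarith
        field_simp; norm_num

/-- For small corrections `direction` is nearly a positive multiple of p. This positivity is what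
allows the monotonicity of c and f in z to be used. -/
theorem inner_direction_nonneg (h : Large η q B p) {b : V} (hb : ‖b‖ ≤ B) :
    0 ≤ inner ℝ (direction η q p b) p := by
  have h0 := h.two_le
  have h1 := h.abs_mul_le
  have h2 := h.rpow_pos
  have h3 := h.norm_corrected_le hb
  have h5 := h.norm_le
  have h6 := abs_real_inner_le_norm (corrected η q p b) b
  have h7 := h.norm_corrected_sub_le hb
  have h8 := h.sq_eq
  have h9 := h.le_one
  have h10 := h.pos
  rw [direction, inner_smul_left]
  refine mul_nonneg (by simp; positivity) ?_
  rw [inner_sub_left, inner_smul_left, real_inner_self_eq_norm_sq]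
  have h11 : inner ℝ (corrected η q p b) p = ‖p‖ ^ 2 + inner ℝ (corrected η q p b - p) p := by
    rw [inner_sub_left, real_inner_self_eq_norm_sq]; ring
  have h12 := neg_le_of_abs_le (abs_real_inner_le_norm (corrected η q p b - p) p)
  rw [h11]
  simp only [conj_trivial]
  generalize √(η ^ 2 + ‖p‖ ^ 2) = v at *
  generalize v ^ (-q) = θ at *
  have hB := h.B_nonneg
  have h13 : |inner ℝ (corrected η q p b) b| ≤ 2 * v * B :=
      h6.trans (mul_le_mul h3 hb (norm_nonneg _) (by linarith))
  have h14 : (1 - q) * θ / v * inner ℝ (corrected η q p b) b ≤ 2 / 100 := by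
    refine (le_abs_self _).trans ?_
    rw [abs_mul, abs_div, abs_mul, abs_of_pos h2, abs_of_pos (show 0 < v by linarith)]
    calc _ ≤ |1 - q| * θ / v * (2 * v * B) := by gcongr
      _ = 2 * (|1 - q| * (θ * B)) := by field_simp
      _ ≤ 2 / 100 := by linarith
  have h15 : ‖corrected η q p b - p‖ * ‖p‖ ≤ v / 100 * v :=
    mul_le_mul h7 h5 (norm_nonneg _) (by linarith)
  have h16 := mul_le_mul_of_nonneg_right h14 (sq_nonneg ‖p‖)
  -- The conditions η ≤ 1 and v ≥ 2 give |p|² = v² − η² ≥ ¾ v², which dominates both errors.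
  nlinarith

-- Concavity of the logarithm costs nothing here, because its negative term is handled by the
-- first-order condition in `half_log_max_conditions`. So |P'|² survives in full and is close to
-- |p₁|². The contributions of b, b₁ and b₂ carry a factor v^{-q} B and are small multiples of |p₁|²
-- + v². The v² part is absorbed by the −1, since η² + |P|² ≥ v²/2.
set_option maxHeartbeats 800000 in
theorem second_order_lower_bound (h : Large η q B p) {b b₁ b₂ p₁ p₂ : V} (hb : ‖b‖ ≤ B)
    (hb₁ : ‖b₁‖ ≤ B) (hb₂ : ‖b₂‖ ≤ B) :
    inner ℝ (direction η q p b) p₂ + ‖p₁‖ ^ 2 / (8 * √(η ^ 2 + ‖p‖ ^ 2) ^ 2) - 1 ≤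
      (‖correctedDeriv η q p b p₁ b₁‖ ^ 2 +
        inner ℝ (corrected η q p b) (correctedDeriv₂ η q p b p₁ b₁ p₂ b₂)) /
        (η ^ 2 + ‖corrected η q p b‖ ^ 2) := by
  have h0 := h.two_le
  have hv : 0 < √(η ^ 2 + ‖p‖ ^ 2) := by linarith
  have h1 := h.abs_mul_le
  have h1' := h.abs_mul_le'
  have h2 := h.rpow_pos
  have h3 := h.norm_corrected_le hb
  obtain ⟨h4, h4'⟩ := h.energy_bounds hb
  have h5 := h.norm_le
  have h6 := h.mul_le
  have hB := h.B_nonneg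
  have hqp := h.q_pos
  have hE : 0 < η ^ 2 + ‖corrected η q p b‖ ^ 2 := by have := h.pos; positivity
  have hc : |inner ℝ (corrected η q p b) b| ≤ 2 * √(η ^ 2 + ‖p‖ ^ 2) * B :=
    (abs_real_inner_le_norm _ _).trans (mul_le_mul h3 hb (norm_nonneg _) (by positivity))
  have hc1 : |inner ℝ (corrected η q p b) b₁| ≤ 2 * √(η ^ 2 + ‖p‖ ^ 2) * B :=
    (abs_real_inner_le_norm _ _).trans (mul_le_mul h3 hb₁ (norm_nonneg _) (by positivity))
  have hc2 : |inner ℝ (corrected η q p b) b₂| ≤ 2 * √(η ^ 2 + ‖p‖ ^ 2) * B :=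
    (abs_real_inner_le_norm _ _).trans (mul_le_mul h3 hb₂ (norm_nonneg _) (by positivity))
  have hv1 : |inner ℝ p p₁ / √(η ^ 2 + ‖p‖ ^ 2)| ≤ ‖p₁‖ := by
    rw [abs_div, abs_of_pos hv, div_le_iff₀ hv]
    refine (abs_real_inner_le_norm _ _).trans ?_
    rw [mul_comm]; gcongr
  have hD : ‖correctedDeriv η q p b p₁ b₁ - p₁‖ ≤ (‖p₁‖ + √(η ^ 2 + ‖p‖ ^ 2)) / 100 := by
    have e : correctedDeriv η q p b p₁ b₁ - p₁ =
      - (((1 - q) * √(η ^ 2 + ‖p‖ ^ 2) ^ (-q) * (inner ℝ p p₁ / √(η ^ 2 + ‖p‖ ^ 2))) • b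
      + (√(η ^ 2 + ‖p‖ ^ 2) * √(η ^ 2 + ‖p‖ ^ 2) ^ (-q)) • b₁) := by
        rw [correctedDeriv, h.rpow_eq]; abel
    rw [e, norm_neg]
    refine (norm_add_le _ _).trans ?_
    rw [norm_smul, norm_smul, norm_mul, norm_mul, norm_mul, Real.norm_of_nonneg h2.le,
      Real.norm_of_nonneg hv.le, Real.norm_eq_abs, Real.norm_eq_abs]
    calc _ ≤ |1 - q| * √(η ^ 2 + ‖p‖ ^ 2) ^ (-q) * ‖p₁‖ * B +
          √(η ^ 2 + ‖p‖ ^ 2) * √(η ^ 2 + ‖p‖ ^ 2) ^ (-q) * B := by gcongr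
      _ = |1 - q| * (√(η ^ 2 + ‖p‖ ^ 2) ^ (-q) * B) * ‖p₁‖ +
          √(η ^ 2 + ‖p‖ ^ 2) * (√(η ^ 2 + ‖p‖ ^ 2) ^ (-q) * B) := by ring
      _ ≤ 1 / 100 * ‖p₁‖ + √(η ^ 2 + ‖p‖ ^ 2) * (1 / 100) := by gcongr
      _ = _ := by ring
  have hD2 : ‖p₁‖ ≤ ‖correctedDeriv η q p b p₁ b₁‖ + (‖p₁‖ + √(η ^ 2 + ‖p‖ ^ 2)) / 100 := by
    have := norm_le_norm_add_norm_sub' p₁ (correctedDeriv η q p b p₁ b₁)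
    rw [norm_sub_rev] at this
    linarith
  -- All occurrences of `p₂`, including the one inside the coefficient of `b`, combine into
  -- `direction`.
  have key : inner ℝ (corrected η q p b) (correctedDeriv₂ η q p b p₁ b₁ p₂ b₂) =
      (η ^ 2 + ‖corrected η q p b‖ ^ 2) * inner ℝ (direction η q p b) p₂
      - ((1 - q) * √(η ^ 2 + ‖p‖ ^ 2) ^ (-q) / √(η ^ 2 + ‖p‖ ^ 2) *
        (‖p₁‖ ^ 2 - (1 + q) * (inner ℝ p p₁ / √(η ^ 2 + ‖p‖ ^ 2)) ^ 2)) *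
          inner ℝ (corrected η q p b) b
      - 2 * ((1 - q) * √(η ^ 2 + ‖p‖ ^ 2) ^ (-q) * (inner ℝ p p₁ / √(η ^ 2 + ‖p‖ ^ 2))) *
          inner ℝ (corrected η q p b) b₁
      - √(η ^ 2 + ‖p‖ ^ 2) * √(η ^ 2 + ‖p‖ ^ 2) ^ (-q) * inner ℝ (corrected η q p b) b₂ := by
    rw [direction, correctedDeriv₂, inner_smul_left, h.rpow_eq]
    simp only [conj_trivial, inner_sub_right, inner_sub_left, inner_smul_left, inner_smul_right]
    rw [mul_inv_cancel_left₀ hE.ne']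
    ring
  rw [key, le_div_iff₀ hE]
  clear key
  generalize √(η ^ 2 + ‖p‖ ^ 2) = v at *
  generalize v ^ (-q) = θ at *
  generalize inner ℝ p p₁ / v = v₁ at *
  generalize inner ℝ (direction η q p b) p₂ = X at *
  generalize inner ℝ (corrected η q p b) b = y at *
  generalize inner ℝ (corrected η q p b) b₁ = y₁ at *
  generalize inner ℝ (corrected η q p b) b₂ = y₂ at *
  generalize ‖correctedDeriv η q p b p₁ b₁‖ = D at *
  generalize η ^ 2 + ‖corrected η q p b‖ ^ 2 = E at *
  have hm : 0 ≤ ‖p₁‖ := norm_nonneg _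
  generalize ‖p₁‖ = m at *
  have hv1sq : v₁ ^ 2 ≤ m ^ 2 := sq_le_sq' (by linarith [neg_le_of_abs_le hv1])
    ((le_abs_self _).trans hv1)
  have t1 : (1 - q) * θ / v * (m ^ 2 - (1 + q) * v₁ ^ 2) * y ≤ m ^ 2 / 25 := by
    refine (le_abs_self _).trans ?_
    rw [abs_mul, abs_mul, abs_div, abs_mul, abs_of_pos h2, abs_of_pos hv]
    have : |m ^ 2 - (1 + q) * v₁ ^ 2| ≤ (1 + q) * m ^ 2 := by
      rw [abs_le]; constructor <;> nlinarith [sq_nonneg v₁, mul_nonneg hqp.le (sq_nonneg m)]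
    calc _ ≤ |1 - q| * θ / v * ((1 + q) * m ^ 2) * (2 * v * B) := by gcongr
      _ = 2 * m ^ 2 * ((1 + q) * |1 - q| * (θ * B)) := by field_simp
      _ ≤ 2 * m ^ 2 * (1 / 100) := by gcongr
      _ ≤ m ^ 2 / 25 := by nlinarith
  have t2 : 2 * ((1 - q) * θ * v₁) * y₁ ≤ m * v / 25 := by
    refine (le_abs_self _).trans ?_
    rw [abs_mul, abs_mul, abs_mul, abs_mul, abs_of_pos h2, abs_of_pos (two_pos)]
    calc _ ≤ 2 * (|1 - q| * θ * m) * (2 * v * B) := by gcongr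
      _ = 4 * (m * v) * (|1 - q| * (θ * B)) := by ring
      _ ≤ 4 * (m * v) * (1 / 100) := by gcongr
      _ = _ := by ring
  have t3 : v * θ * y₂ ≤ v ^ 2 / 50 := by
    refine (le_abs_self _).trans ?_
    rw [abs_mul, abs_mul, abs_of_pos h2, abs_of_pos hv]
    calc _ ≤ v * θ * (2 * v * B) := by gcongr
      _ = 2 * v ^ 2 * (θ * B) := by ring
      _ ≤ 2 * v ^ 2 * (1 / 100) := by gcongr
      _ = _ := by ring
  have t4 : m ^ 2 / (8 * v ^ 2) * E ≤ m ^ 2 / 4 := by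
    calc _ ≤ m ^ 2 / (8 * v ^ 2) * (2 * v ^ 2) := by gcongr
      _ = _ := by field_simp; ring
  have t5 : m ^ 2 * (9 / 10) - v ^ 2 / 10 ≤ D ^ 2 := by
    have a1 : 99 * m - v ≤ 100 * D := by linarith
    rcases le_or_gt (99 * m) v with h | h
    · nlinarith [sq_nonneg D]
    · have : (99 * m - v) ^ 2 ≤ (100 * D) ^ 2 := by
        apply sq_le_sq'  <;> linarith
      nlinarith [sq_nonneg (m - v)]
  have t6 : 2 * (m * v) ≤ m ^ 2 + v ^ 2 := by linarith [two_mul_le_add_sq m v]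
  have t7 : (X + m ^ 2 / (8 * v ^ 2) - 1) * E = E * X + m ^ 2 / (8 * v ^ 2) * E - E := by ring
  have t8 := sq_nonneg m
  linarith

end Large

end

/-! ### Restriction to lines, and a square root of the mean curvature matrix. -/

section

section Lines

variable {V F : Type*} [NormedAddCommGroup V] [NormedSpace ℝ V] [NormedAddCommGroup F]
  [NormedSpace ℝ F]

theorem hasDerivAt_line (x ω : V) (s : ℝ) : HasDerivAt (fun r : ℝ => x + r • ω) ω s := by
  simpa using ((hasDerivAt_id s).smul_const ω).const_add x

theorem eventually_hasDerivAt_comp_line {G : V → F} {x : V} (hG : ContDiffAt ℝ 2 G x) (ω : V) :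
    ∀ᶠ s in 𝓝 (0 : ℝ), HasDerivAt (fun s : ℝ => G (x + s • ω)) (fderiv ℝ G (x + s • ω) ω) s := by
  have h1 : ∀ᶠ y in 𝓝 x, DifferentiableAt ℝ G y :=
    (hG.eventually (by simp)).mono fun y hy => hy.differentiableAt (by simp)
  have h2 : Tendsto (fun s : ℝ => x + s • ω) (𝓝 0) (𝓝 x) := by
    have : Continuous fun s : ℝ => x + s • ω := by fun_prop
    simpa using this.tendsto 0
  filter_upwards [h2.eventually h1] with s hs
  exact hs.hasFDerivAt.comp_hasDerivAt s (hasDerivAt_line x ω s)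

theorem hasDerivAt_fderiv_comp_line {G : V → F} {x : V} (hG : ContDiffAt ℝ 2 G x) (ω : V) :
    HasDerivAt (fun s : ℝ => fderiv ℝ G (x + s • ω) ω) (fderiv ℝ (fderiv ℝ G) x ω ω) 0 := by
  have h1 : DifferentiableAt ℝ (fderiv ℝ G) x :=
    (hG.fderiv_right (m := 1) (by norm_num)).differentiableAt (by simp)
  have h2 : HasFDerivAt (fderiv ℝ G) (fderiv ℝ (fderiv ℝ G) x) (x + (0 : ℝ) • ω) := by
    simpa using h1.hasFDerivAt
  have h3 := h2.comp_hasDerivAt (0 : ℝ) (hasDerivAt_line x ω 0)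
  exact h3.clm_apply (hasDerivAt_const (0 : ℝ) ω) |>.congr_deriv (by simp)

end Lines

section Frame

variable {V ι : Type*} [NormedAddCommGroup V] [InnerProductSpace ℝ V] [Fintype ι]

/-- The columns of the square root of the matrix `I - p ⊗ p / v²`, `v = √(η² + |p|²)`. -/
def frame (η : ℝ) (p : V) (e : OrthonormalBasis ι ℝ V) (k : ι) : V :=
  e k - ((√(η ^ 2 + ‖p‖ ^ 2) * (√(η ^ 2 + ‖p‖ ^ 2) + η))⁻¹ * inner ℝ (e k) p) • p

/-- The map defining `frame` is the identity on the orthogonal complement of p and multiplies p by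
η/v. Its square therefore multiplies p by η²/v² = 1 − |p|²/v², as the matrix I − p ⊗ p / v² does. -/
theorem sum_frame {η : ℝ} (hη : 0 < η) (p : V) (e : OrthonormalBasis ι ℝ V)
    (B : V →ₗ[ℝ] V →ₗ[ℝ] ℝ) :
    ∑ k, B (frame η p e k) (frame η p e k) =
      ∑ k, B (e k) (e k) - B p p / √(η ^ 2 + ‖p‖ ^ 2) ^ 2 := by
  have hv : 0 < √(η ^ 2 + ‖p‖ ^ 2) := by positivity
  have hsq : √(η ^ 2 + ‖p‖ ^ 2) ^ 2 = η ^ 2 + ‖p‖ ^ 2 := Real.sq_sqrt (by positivity)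
  unfold frame
  generalize √(η ^ 2 + ‖p‖ ^ 2) = v at *
  set μ := (v * (v + η))⁻¹ with hμ
  have h1 : ∑ k, inner ℝ (e k) p * B (e k) p = B p p := by
    conv_rhs => enter [1]; rw [← e.sum_repr' p, map_sum]
    simp
  have h2 : ∑ k, inner ℝ (e k) p * B p (e k) = B p p := by
    conv_rhs => rw [← e.sum_repr' p, map_sum]
    conv_rhs => rw [e.sum_repr' p]
    simp
  have h3 : ∑ k, inner ℝ (e k) p * inner ℝ (e k) p = ‖p‖ ^ 2 := by
    rw [← real_inner_self_eq_norm_sq, ← e.sum_inner_mul_inner p p]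
    exact Finset.sum_congr rfl fun k _ => by rw [real_inner_comm p (e k)]
  have h4 : ∀ k, B (e k - (μ * inner ℝ (e k) p) • p) (e k - (μ * inner ℝ (e k) p) • p) =
      B (e k) (e k) - μ * (inner ℝ (e k) p * B (e k) p) - μ * (inner ℝ (e k) p * B p (e k))
        + μ ^ 2 * B p p * (inner ℝ (e k) p * inner ℝ (e k) p) := by
    intro k
    simp only [map_sub, map_smul, LinearMap.sub_apply, LinearMap.smul_apply,
      smul_eq_mul]
    ring
  rw [Finset.sum_congr rfl fun k _ => h4 k, Finset.sum_add_distrib, Finset.sum_sub_distrib,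
    Finset.sum_sub_distrib, ← Finset.mul_sum, ← Finset.mul_sum, ← Finset.mul_sum, h1, h2, h3]
  have h5 : ‖p‖ ^ 2 = (v - η) * (v + η) := by linarith
  have h6 : v + η ≠ 0 := by positivity
  rw [h5, hμ]
  field_simp
  ring

theorem norm_frame_le {η : ℝ} (hη : 0 < η) (p : V) (e : OrthonormalBasis ι ℝ V) (k : ι) :
    ‖frame η p e k‖ ≤ 2 := by
  have hv : 0 < √(η ^ 2 + ‖p‖ ^ 2) := by positivity
  have hp : ‖p‖ ≤ √(η ^ 2 + ‖p‖ ^ 2) := Real.le_sqrt_of_sq_le (by nlinarith)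
  have h1 := (norm_sub_le (e k)
    (((√(η ^ 2 + ‖p‖ ^ 2) * (√(η ^ 2 + ‖p‖ ^ 2) + η))⁻¹ * inner ℝ (e k) p) • p))
  have h2 : ‖e k‖ = 1 := e.norm_eq_one k
  have h3 := abs_real_inner_le_norm (e k) p
  rw [h2, one_mul] at h3
  refine h1.trans ?_
  rw [norm_smul, norm_mul, norm_inv, Real.norm_of_nonneg (by positivity), Real.norm_eq_abs, h2]
  generalize √(η ^ 2 + ‖p‖ ^ 2) = v at *
  have : (v * (v + η))⁻¹ * |inner ℝ (e k) p| * ‖p‖ ≤ (v * v)⁻¹ * v * v := by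
    gcongr
    · linarith
    · linarith
  have h4 : (v * v)⁻¹ * v * v = 1 := by field_simp
  linarith

end Frame

end

/-! ### Consequences of a spatial maximum, and the differentiated operator. -/

section

variable {V ι : Type*} [NormedAddCommGroup V] [InnerProductSpace ℝ V] [Fintype ι]

/-- Bounds of order zero, one and two for a function at a point. -/
structure JetBound {W : Type*} [NormedAddCommGroup W] [NormedSpace ℝ W] (B : ℝ) (G : V → W)
    (x : V) : Prop where
  contDiffAt : ContDiffAt ℝ 2 G x
  zero : ‖G x‖ ≤ B
  one : ∀ ω, ‖fderiv ℝ G x ω‖ ≤ B * ‖ω‖ / 2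
  two : ∀ ω, ‖fderiv ℝ (fderiv ℝ G) x ω ω‖ ≤ B * ‖ω‖ ^ 2 / 4

theorem max_conditions_of_jetBound {H b : V → V} {h : V → ℝ} {x : V} {η q B N K : ℝ} (hK : 0 ≤ K)
    (hL : Large η q B (H x)) (hH : ContDiffAt ℝ 2 H x) (hb : JetBound B b x)
    (hh : JetBound N h x)
    (hmax : IsLocalMax
      (fun y => Real.log (η ^ 2 + ‖corrected η q (H y) (b y)‖ ^ 2) / 2 + K * h y) x) (ω : V)
    (hω : ‖ω‖ ≤ 2) :
    |inner ℝ (direction η q (H x) (b x)) (fderiv ℝ H x ω)| ≤ 2 * (1 + K * N) ∧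
    inner ℝ (direction η q (H x) (b x)) (fderiv ℝ (fderiv ℝ H) x ω ω) +
      ‖fderiv ℝ H x ω‖ ^ 2 / (8 * √(η ^ 2 + ‖H x‖ ^ 2) ^ 2) ≤ 1 + 2 * (K * N) ^ 2 + K * N := by
  have hη := hL.pos
  have hN : 0 ≤ N := (norm_nonneg _).trans hh.zero
  have hline : Tendsto (fun s : ℝ => x + s • ω) (𝓝 0) (𝓝 x) := by
    have : Continuous fun s : ℝ => x + s • ω := by fun_prop
    simpa using this.tendsto 0
  have hH1 := eventually_hasDerivAt_comp_line hH ω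
  have hH2 := hasDerivAt_fderiv_comp_line hH ω
  have hb1 := eventually_hasDerivAt_comp_line hb.contDiffAt ω
  have hb2 := hasDerivAt_fderiv_comp_line hb.contDiffAt ω
  have hP : ∀ᶠ s in 𝓝 (0 : ℝ), HasDerivAt
      (fun s : ℝ => corrected η q (H (x + s • ω)) (b (x + s • ω)))
      (correctedDeriv η q (H (x + s • ω)) (b (x + s • ω)) (fderiv ℝ H (x + s • ω) ω)
        (fderiv ℝ b (x + s • ω) ω)) s := by
    filter_upwards [hH1, hb1] with s h1 h2
    exact hasDerivAt_corrected hη h1 h2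
  have hP1 := hasDerivAt_correctedDeriv (q := q) hη hH1.self_of_nhds hb1.self_of_nhds hH2 hb2
  have hm : IsLocalMax (fun s : ℝ => Real.log (η ^ 2 +
      ‖corrected η q (H (x + s • ω)) (b (x + s • ω))‖ ^ 2) / 2 + K * h (x + s • ω)) 0 := by
    have := hline.eventually hmax
    filter_upwards [this] with s hs
    simpa using hs
  obtain ⟨f1, f2⟩ := half_log_max_conditions hη hP hP1
    (eventually_hasDerivAt_comp_line hh.contDiffAt ω)
    (hasDerivAt_fderiv_comp_line hh.contDiffAt ω) hm
  simp only [zero_smul, add_zero] at f1 f2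
  -- The factors 1/2 and 1/4 in `JetBound` are chosen so that every ω with |ω| ≤ 2, in particular
  -- every frame vector, gives the plain bounds B and N.
  have hb1' : ‖fderiv ℝ b x ω‖ ≤ B := (hb.one ω).trans (by nlinarith [hL.B_nonneg])
  have hb2' : ‖fderiv ℝ (fderiv ℝ b) x ω ω‖ ≤ B := (hb.two ω).trans (by
    have : ‖ω‖ ^ 2 ≤ 2 ^ 2 := by gcongr
    nlinarith [hL.B_nonneg])
  have hh1' : |fderiv ℝ h x ω| ≤ N := (hh.one ω).trans (by nlinarith)
  have hh2' : |fderiv ℝ (fderiv ℝ h) x ω ω| ≤ N := (hh.two ω).trans (by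
    have : ‖ω‖ ^ 2 ≤ 2 ^ 2 := by gcongr
    nlinarith)
  have hKh : |K * fderiv ℝ h x ω| ≤ K * N := by
    rw [abs_mul, abs_of_nonneg hK]; gcongr
  constructor
  · rw [inner_corrected_correctedDeriv] at f1
    have h0 := hL.two_le
    have hE := (hL.energy_bounds hb.zero).1
    have hP3 := hL.norm_corrected_le hb.zero
    have hmul := hL.mul_le
    have hθ := hL.rpow_pos
    have hpos : 0 < η ^ 2 + ‖corrected η q (H x) (b x)‖ ^ 2 := by positivity
    have hi : |inner ℝ (corrected η q (H x) (b x)) (fderiv ℝ b x ω)| ≤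
        2 * √(η ^ 2 + ‖H x‖ ^ 2) * B :=
      (abs_real_inner_le_norm _ _).trans (mul_le_mul hP3 hb1' (norm_nonneg _) (by positivity))
    rw [hL.rpow_eq] at f1
    have h5 : |√(η ^ 2 + ‖H x‖ ^ 2) * √(η ^ 2 + ‖H x‖ ^ 2) ^ (-q) *
        inner ℝ (corrected η q (H x) (b x)) (fderiv ℝ b x ω) /
          (η ^ 2 + ‖corrected η q (H x) (b x)‖ ^ 2)| ≤ 1 := by
      rw [abs_div, abs_of_pos hpos, div_le_one hpos, abs_mul, abs_mul, abs_of_pos hθ,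
        abs_of_nonneg (Real.sqrt_nonneg _)]
      refine le_trans ?_ hE
      generalize √(η ^ 2 + ‖H x‖ ^ 2) = v at *
      calc _ ≤ v * v ^ (-q) * (2 * v * B) := by gcongr
        _ = 2 * v ^ 2 * (v ^ (-q) * B) := by ring
        _ ≤ 2 * v ^ 2 * (1 / 100) := by gcongr
        _ ≤ _ := by nlinarith
    rw [abs_le] at h5 hKh ⊢
    constructor <;> nlinarith [mul_nonneg hK hN]
  · have h3 := hL.second_order_lower_bound (p₁ := fderiv ℝ H x ω)
      (p₂ := fderiv ℝ (fderiv ℝ H) x ω ω) hb.zero hb1' hb2'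
    have h4 : (K * fderiv ℝ h x ω) ^ 2 ≤ (K * N) ^ 2 :=
      sq_le_sq' (neg_le_of_abs_le hKh) ((le_abs_self _).trans hKh)
    have h6 : -(K * N) ≤ K * fderiv ℝ (fderiv ℝ h) x ω ω := by
      have := neg_le_of_abs_le hh2'
      nlinarith
    linarith

/-- A symmetric derivative makes H locally a gradient field, so its second derivative is totally
symmetric. This trades the second derivative along ω, paired with ξ, for the ξ-derivative of the
Hessian evaluated on (ω, ω), which is what the differentiated equation contains. -/
theorem inner_fderiv_fderiv_symm {H : V → V} {x : V} (hH : ContDiffAt ℝ 2 H x)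
    (hsym : ∀ᶠ y in 𝓝 x, ∀ a c, inner ℝ (fderiv ℝ H y a) c = inner ℝ a (fderiv ℝ H y c))
    (ω ξ : V) :
    inner ℝ ξ (fderiv ℝ (fderiv ℝ H) x ω ω) = inner ℝ (fderiv ℝ (fderiv ℝ H) x ξ ω) ω := by
  have h1 : DifferentiableAt ℝ (fderiv ℝ H) x :=
    (hH.fderiv_right (m := 1) (by norm_num)).differentiableAt (by simp)
  have h2 : ∀ a c d, inner ℝ (fderiv ℝ (fderiv ℝ H) x d a) c =
      inner ℝ a (fderiv ℝ (fderiv ℝ H) x d c) := by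
    intro a c d
    have e1 := ((h1.hasFDerivAt.clm_apply (hasFDerivAt_const a x)).inner ℝ (hasFDerivAt_const c x))
    have e2 := ((hasFDerivAt_const a x).inner ℝ (h1.hasFDerivAt.clm_apply (hasFDerivAt_const c x)))
    have e3 : (fun y => inner ℝ (fderiv ℝ H y a) c) =ᶠ[𝓝 x]
        fun y => inner ℝ a (fderiv ℝ H y c) := hsym.mono fun y hy => hy a c
    have e4 := e1.unique (e2.congr_of_eventuallyEq e3)
    simpa using congrArg (fun L => L d) e4
  have h3 : fderiv ℝ (fderiv ℝ H) x ω ξ = fderiv ℝ (fderiv ℝ H) x ξ ω :=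
    (hH.isSymmSndFDerivAt (by simp)) ω ξ
  rw [← h2, h3]

theorem deriv_mean_curvature_operator {H : V → V} {x : V} {η : ℝ} (hη : 0 < η)
    (hH : ContDiffAt ℝ 2 H x) (e : OrthonormalBasis ι ℝ V) (ξ : V) {c f : V → ℝ} {c' f' : ℝ}
    (hc : HasDerivAt (fun s : ℝ => c (x + s • ξ)) c' 0)
    (hf : HasDerivAt (fun s : ℝ => f (x + s • ξ)) f' 0) :
    HasDerivAt (fun s : ℝ => ∑ i, inner ℝ (fderiv ℝ H (x + s • ξ) (e i)) (e i) -
        inner ℝ (fderiv ℝ H (x + s • ξ) (H (x + s • ξ))) (H (x + s • ξ)) /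
          (η ^ 2 + ‖H (x + s • ξ)‖ ^ 2) +
        c (x + s • ξ) * √(η ^ 2 + ‖H (x + s • ξ)‖ ^ 2) - f (x + s • ξ))
      (∑ i, inner ℝ (fderiv ℝ (fderiv ℝ H) x ξ (e i)) (e i) -
        ((inner ℝ (fderiv ℝ (fderiv ℝ H) x ξ (H x)) (H x) +
          inner ℝ (fderiv ℝ H x (fderiv ℝ H x ξ)) (H x) +
          inner ℝ (fderiv ℝ H x (H x)) (fderiv ℝ H x ξ)) / (η ^ 2 + ‖H x‖ ^ 2) -
          inner ℝ (fderiv ℝ H x (H x)) (H x) * (2 * inner ℝ (H x) (fderiv ℝ H x ξ)) /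
            (η ^ 2 + ‖H x‖ ^ 2) ^ 2) +
        (c' * √(η ^ 2 + ‖H x‖ ^ 2) +
          c x * (inner ℝ (H x) (fderiv ℝ H x ξ) / √(η ^ 2 + ‖H x‖ ^ 2))) - f') 0 := by
  have h1 : DifferentiableAt ℝ (fderiv ℝ H) x :=
    (hH.fderiv_right (m := 1) (by norm_num)).differentiableAt (by simp)
  have h2 : HasFDerivAt (fderiv ℝ H) (fderiv ℝ (fderiv ℝ H) x) (x + (0 : ℝ) • ξ) := by
    simpa using h1.hasFDerivAt
  have hA : HasDerivAt (fun s : ℝ => fderiv ℝ H (x + s • ξ)) (fderiv ℝ (fderiv ℝ H) x ξ) 0 :=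
    h2.comp_hasDerivAt (0 : ℝ) (hasDerivAt_line x ξ 0)
  have hp : HasDerivAt (fun s : ℝ => H (x + s • ξ)) (fderiv ℝ H x ξ) 0 := by
    simpa using (eventually_hasDerivAt_comp_line hH ξ).self_of_nhds
  have hne : η ^ 2 + ‖H (x + (0 : ℝ) • ξ)‖ ^ 2 ≠ 0 := by positivity
  have t1 : HasDerivAt (fun s : ℝ => ∑ i, inner ℝ (fderiv ℝ H (x + s • ξ) (e i)) (e i))
      (∑ i, inner ℝ (fderiv ℝ (fderiv ℝ H) x ξ (e i)) (e i)) 0 := by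
    refine HasDerivAt.fun_sum fun i _ => ?_
    have := (hA.clm_apply (hasDerivAt_const (0 : ℝ) (e i))).inner ℝ (hasDerivAt_const (0 : ℝ) (e i))
    simpa using this
  have t2 := ((hA.clm_apply hp).inner ℝ hp).div (hp.norm_sq.const_add (η ^ 2)) hne
  have t3 := hc.mul (hasDerivAt_sqrt_add_norm_sq hη hp)
  refine (((t1.sub t2).add t3).sub hf).congr_deriv ?_
  simp only [zero_smul, add_zero, inner_add_left] at hne ⊢
  field_simp
  ring

end

/-! ### The differentiated equation at an interior maximum. -/

section

variable {V ι : Type*} [NormedAddCommGroup V] [InnerProductSpace ℝ V] [Fintype ι]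

/-- The bound for the derivative of the right hand side of the equation at an interior maximum. -/
def interiorConst (n : ℕ) (N K C : ℝ) : ℝ :=
  n * (1 + 2 * (K * N) ^ 2 + K * N + 32 * (1 + K * N) ^ 2) + (16 * C + C * (2 * (1 + K * N)))

/-- In the frame, the left side is a sum of terms D²H(ξ, ω) · ω − (2/v²)(Ap · ω)(Aξ · ω), with p = H
x and A = DH. The first factor of the product is at most v |Aω|, and the second is bounded by the
first-order condition. With s = |Aω|/v the product costs at most 4(1 + KN)s, while the second-order
condition supplies −s²/8; the maximum of their sum is 32(1 + KN)². -/
theorem sum_second_deriv_le {H b : V → V} {h : V → ℝ} {x : V} {η q B N K : ℝ} (hK : 0 ≤ K)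
    (hL : Large η q B (H x)) (hH : ContDiffAt ℝ 2 H x) (hb : JetBound B b x)
    (hh : JetBound N h x)
    (hmax : IsLocalMax
      (fun y => Real.log (η ^ 2 + ‖corrected η q (H y) (b y)‖ ^ 2) / 2 + K * h y) x)
    (hsym : ∀ᶠ y in 𝓝 x, ∀ a c, inner ℝ (fderiv ℝ H y a) c = inner ℝ a (fderiv ℝ H y c))
    (e : OrthonormalBasis ι ℝ V) (ξ : V) (hξ : ξ = direction η q (H x) (b x)) :
    ∑ i, inner ℝ (fderiv ℝ (fderiv ℝ H) x ξ (e i)) (e i) -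
        ((inner ℝ (fderiv ℝ (fderiv ℝ H) x ξ (H x)) (H x) +
          inner ℝ (fderiv ℝ H x (fderiv ℝ H x ξ)) (H x) +
          inner ℝ (fderiv ℝ H x (H x)) (fderiv ℝ H x ξ)) / (η ^ 2 + ‖H x‖ ^ 2) -
          inner ℝ (fderiv ℝ H x (H x)) (H x) * (2 * inner ℝ (H x) (fderiv ℝ H x ξ)) /
            (η ^ 2 + ‖H x‖ ^ 2) ^ 2) ≤
      Fintype.card ι * (1 + 2 * (K * N) ^ 2 + K * N + 32 * (1 + K * N) ^ 2) := by
  have hη := hL.pos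
  have hN : 0 ≤ N := (norm_nonneg _).trans hh.zero
  have hv : 0 < √(η ^ 2 + ‖H x‖ ^ 2) := by linarith [hL.two_le]
  have hs := hsym.self_of_nhds
  set A := fderiv ℝ H x with hA
  set D := fderiv ℝ (fderiv ℝ H) x with hD
  let B₁ : V →ₗ[ℝ] V →ₗ[ℝ] ℝ := LinearMap.mk₂ ℝ (fun a c => inner ℝ (D ξ a) c)
    (by intros; simp [inner_add_left]) (by intros; simp [inner_smul_left])
    (by intros; simp [inner_add_right]) (by intros; simp [inner_smul_right])
  let B₂ : V →ₗ[ℝ] V →ₗ[ℝ] ℝ := LinearMap.mk₂ ℝ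
    (fun a c => inner ℝ (A (H x)) a * inner ℝ (A ξ) c)
    (by intros; simp [inner_add_right, add_mul]) (by intros; simp [inner_smul_right, mul_assoc])
    (by intros; simp [inner_add_right, mul_add])
    (by intros; simp [inner_smul_right, mul_left_comm])
  have s1 := sum_frame hη (H x) e B₁
  have s2 := sum_frame hη (H x) e B₂
  simp only [B₁, B₂, LinearMap.mk₂_apply] at s1 s2
  have s3 : ∑ k, inner ℝ (A (H x)) (e k) * inner ℝ (A ξ) (e k) = inner ℝ (A (H x)) (A ξ) := by
    rw [← e.sum_inner_mul_inner (A (H x)) (A ξ)]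
    exact Finset.sum_congr rfl fun k _ => by rw [real_inner_comm (e k) (A ξ)]
  rw [s3] at s2
  have hsq := hL.sq_eq
  rw [← hsq, hs (A ξ) (H x), real_inner_comm (A (H x)) (A ξ), real_inner_comm (A ξ) (H x)]
  have e1 : ∀ y : ℝ, (∑ i, inner ℝ (D ξ (e i)) (e i) -
        ((inner ℝ (D ξ (H x)) (H x) + inner ℝ (A (H x)) (A ξ) + inner ℝ (A (H x)) (A ξ)) / y ^ 2 -
          inner ℝ (A (H x)) (H x) * (2 * inner ℝ (A ξ) (H x)) / (y ^ 2) ^ 2)) =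
      (∑ i, inner ℝ (D ξ (e i)) (e i) - inner ℝ (D ξ (H x)) (H x) / y ^ 2)
       - 2 / y ^ 2 * (inner ℝ (A (H x)) (A ξ) -
          inner ℝ (A (H x)) (H x) * inner ℝ (A ξ) (H x) / y ^ 2) := by
    intro y
    ring
  rw [e1, ← s1, ← s2, Finset.mul_sum, ← Finset.sum_sub_distrib]
  rw [← Finset.card_univ, ← nsmul_eq_mul]
  refine Finset.sum_le_card_nsmul _ _ _ fun k _ => ?_
  obtain ⟨m1, m2⟩ := max_conditions_of_jetBound hK hL hH hb hh hmax (frame η (H x) e k)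
    (norm_frame_le hη _ _ _)
  rw [← hξ] at m1 m2
  rw [inner_fderiv_fderiv_symm hH hsym] at m2
  rw [← hD] at m2
  rw [← hA] at m1 m2
  rw [hs ξ, hs (H x)]
  have m3 := abs_real_inner_le_norm (H x) (A (frame η (H x) e k))
  have hp := hL.norm_le
  generalize inner ℝ (H x) (A (frame η (H x) e k)) = y at *
  generalize inner ℝ ξ (A (frame η (H x) e k)) = z at *
  generalize inner ℝ (D ξ (frame η (H x) e k)) (frame η (H x) e k) = X at *
  have hm : 0 ≤ ‖A (frame η (H x) e k)‖ := norm_nonneg _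
  generalize ‖A (frame η (H x) e k)‖ = m at *
  generalize √(η ^ 2 + ‖H x‖ ^ 2) = v at *
  have hc : 0 ≤ 1 + K * N := by positivity
  have t1 : -(2 / v ^ 2 * (y * z)) ≤ 4 * (1 + K * N) * (m / v) := by
    refine (neg_le_abs _).trans ?_
    rw [abs_mul, abs_mul, abs_of_nonneg (show (0 : ℝ) ≤ 2 / v ^ 2 by positivity)]
    have : |y| ≤ v * m := m3.trans (by gcongr)
    calc _ ≤ 2 / v ^ 2 * ((v * m) * (2 * (1 + K * N))) := by gcongr
      _ = _ := by field_simp; ring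
  have t2 : m ^ 2 / (8 * v ^ 2) = (m / v) ^ 2 / 8 := by field_simp
  rw [t2] at m2
  nlinarith [sq_nonneg (m / v - 16 * (1 + K * N))]

/-- At an interior maximum the derivative of the right hand side of the equation in the direction
`direction` is bounded. -/
theorem deriv_source_le {H b : V → V} {h : V → ℝ} {x : V} {η q B N K C : ℝ} (hK : 0 ≤ K)
    (hL : Large η q B (H x)) (hH : ContDiffAt ℝ 2 H x) (hb : JetBound B b x)
    (hh : JetBound N h x)
    (hmax : IsLocalMax
      (fun y => Real.log (η ^ 2 + ‖corrected η q (H y) (b y)‖ ^ 2) / 2 + K * h y) x)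
    (hsym : ∀ᶠ y in 𝓝 x, ∀ a c, inner ℝ (fderiv ℝ H y a) c = inner ℝ a (fderiv ℝ H y c))
    (e : OrthonormalBasis ι ℝ V) {g c f : V → ℝ} {g' : V →L[ℝ] ℝ} (hg : HasFDerivAt g g' x)
    (hgeq : g =ᶠ[𝓝 x] fun y => ∑ i, inner ℝ (fderiv ℝ H y (e i)) (e i) -
        inner ℝ (fderiv ℝ H y (H y)) (H y) / (η ^ 2 + ‖H y‖ ^ 2) +
        c y * √(η ^ 2 + ‖H y‖ ^ 2) - f y)
    {cx fx : V} {cz fz : ℝ}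
    (hc : HasFDerivAt c (innerSL ℝ (cx + cz • H x)) x)
    (hf : HasFDerivAt f (innerSL ℝ (fx + fz • H x)) x)
    (hC : |c x| ≤ C) (hcx : ‖cx‖ ≤ C) (hfx : ‖fx‖ ≤ C) (hcz : cz ≤ 0) (hfz : 0 ≤ fz) :
    g' (direction η q (H x) (b x)) ≤ interiorConst (Fintype.card ι) N K C := by
  have hN : 0 ≤ N := (norm_nonneg _).trans hh.zero
  have hC0 : 0 ≤ C := (norm_nonneg _).trans hcx
  have h2 := hL.two_le
  have hv : 0 < √(η ^ 2 + ‖H x‖ ^ 2) := by linarith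
  set ξ := direction η q (H x) (b x) with hξ
  have hline : Tendsto (fun s : ℝ => x + s • ξ) (𝓝 0) (𝓝 x) := by
    have : Continuous fun s : ℝ => x + s • ξ := by fun_prop
    simpa using this.tendsto 0
  have line : ∀ {F : V → ℝ} {F' : V →L[ℝ] ℝ}, HasFDerivAt F F' x →
      HasDerivAt (fun s : ℝ => F (x + s • ξ)) (F' ξ) 0 := by
    intro F F' hF
    have : HasFDerivAt F F' (x + (0 : ℝ) • ξ) := by simpa using hF
    exact this.comp_hasDerivAt (0 : ℝ) (hasDerivAt_line x ξ 0)
  have d1 := deriv_mean_curvature_operator hL.pos hH e ξ (line hc) (line hf)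
  have d2 := (line hg).congr_of_eventuallyEq
    (f₁ := fun s : ℝ => ∑ i, inner ℝ (fderiv ℝ H (x + s • ξ) (e i)) (e i) -
        inner ℝ (fderiv ℝ H (x + s • ξ) (H (x + s • ξ))) (H (x + s • ξ)) /
          (η ^ 2 + ‖H (x + s • ξ)‖ ^ 2) +
        c (x + s • ξ) * √(η ^ 2 + ‖H (x + s • ξ)‖ ^ 2) - f (x + s • ξ))
    ((hline.eventually hgeq).mono fun s hs => hs.symm)
  rw [d2.unique d1, interiorConst]
  have m := sum_second_deriv_le hK hL hH hb hh hmax hsym e ξ hξ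
  have hn := hL.norm_direction_le hb.zero
  have hp := hL.inner_direction_nonneg hb.zero
  rw [← hξ] at hn hp
  -- By symmetry p · Aξ / v = ξ · A(p/v), so the first-order condition applies along the vector p/v,
  -- of norm at most 1.
  have hx : |inner ℝ (H x) (fderiv ℝ H x ξ) / √(η ^ 2 + ‖H x‖ ^ 2)| ≤ 2 * (1 + K * N) := by
    have hle : ‖(√(η ^ 2 + ‖H x‖ ^ 2))⁻¹ • H x‖ ≤ 2 := by
      rw [norm_smul, norm_inv, Real.norm_of_nonneg hv.le, inv_mul_le_iff₀ hv]
      linarith [hL.norm_le]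
    have := (max_conditions_of_jetBound hK hL hH hb hh hmax _ hle).1
    rw [← hξ, ← hsym.self_of_nhds, inner_smul_right, real_inner_comm] at this
    rwa [div_eq_inv_mul]
  have i1 : ∀ a : V, ‖a‖ ≤ C → |inner ℝ a ξ| ≤ C * (8 / √(η ^ 2 + ‖H x‖ ^ 2)) := fun a ha =>
    (abs_real_inner_le_norm a ξ).trans (mul_le_mul ha hn (norm_nonneg _) hC0)
  have i2 := (le_abs_self _).trans (i1 cx hcx)
  have i3 := (neg_le_abs _).trans (i1 fx hfx)
  simp only [innerSL_apply_apply, inner_add_left, inner_smul_left, conj_trivial]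
  rw [real_inner_comm] at hp
  -- The factor v multiplying D_x c is compensated by |ξ| ≤ 8/v. The c_z term has no usable bound
  -- and is dropped by its sign.
  have j1 : (inner ℝ cx ξ + cz * inner ℝ (H x) ξ) * √(η ^ 2 + ‖H x‖ ^ 2) ≤ 8 * C := by
    calc _ ≤ (C * (8 / √(η ^ 2 + ‖H x‖ ^ 2))) * √(η ^ 2 + ‖H x‖ ^ 2) := by
          gcongr; nlinarith
      _ = _ := by field_simp
  have j2 : c x * (inner ℝ (H x) (fderiv ℝ H x ξ) / √(η ^ 2 + ‖H x‖ ^ 2)) ≤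
      C * (2 * (1 + K * N)) := by
    refine (le_abs_self _).trans ?_
    rw [abs_mul]
    gcongr
  have j3 : C * (8 / √(η ^ 2 + ‖H x‖ ^ 2)) ≤ 8 * C := by
    rw [mul_comm]
    gcongr
    rw [div_le_iff₀ hv]; linarith
  have j4 : 0 ≤ fz * inner ℝ (H x) ξ := mul_nonneg hfz hp
  linarith

end

/-! ### First-order conditions at a boundary maximum. -/

section

variable {V : Type*} [NormedAddCommGroup V] [InnerProductSpace ℝ V]

theorem differentiable_sqrt_add_norm_sq {η : ℝ} (hη : 0 < η) :
    Differentiable ℝ (fun p : V => √(η ^ 2 + ‖p‖ ^ 2)) := fun p =>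
  (((differentiable_id.norm_sq ℝ) p).const_add (η ^ 2)).sqrt (by positivity)

theorem differentiable_corrected {η : ℝ} (hη : 0 < η) (q : ℝ) :
    Differentiable ℝ (fun z : V × V => corrected η q z.1 z.2) := by
  intro z
  have h1 : DifferentiableAt ℝ (fun z : V × V => √(η ^ 2 + ‖z.1‖ ^ 2)) z :=
    (differentiable_sqrt_add_norm_sq hη z.1).comp z differentiableAt_fst
  have h2 : DifferentiableAt ℝ (fun z : V × V => √(η ^ 2 + ‖z.1‖ ^ 2) ^ (1 - q)) z :=
    h1.rpow_const (Or.inl (by positivity))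
  exact differentiableAt_fst.sub (h2.smul differentiableAt_snd)

theorem differentiable_half_log_corrected {η : ℝ} (hη : 0 < η) (q : ℝ) :
    Differentiable ℝ (fun z : V × V => Real.log (η ^ 2 + ‖corrected η q z.1 z.2‖ ^ 2) / 2) := by
  intro z
  have h1 := ((differentiable_corrected (V := V) hη q z).norm_sq ℝ).const_add (η ^ 2)
  simpa only [div_eq_mul_inv] using (h1.log (by positivity)).mul_const (2 : ℝ)⁻¹

theorem fderiv_corrected {η : ℝ} (hη : 0 < η) (q : ℝ) (p b p₁ b₁ : V) :
    fderiv ℝ (fun z : V × V => corrected η q z.1 z.2) (p, b) (p₁, b₁) =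
      correctedDeriv η q p b p₁ b₁ := by
  have h1 := hasDerivAt_corrected (q := q) hη (hasDerivAt_line p p₁ 0) (hasDerivAt_line b b₁ 0)
  have h2 : HasFDerivAt (fun z : V × V => corrected η q z.1 z.2) _
    (p + (0 : ℝ) • p₁, b + (0 : ℝ) • b₁) := (differentiable_corrected hη q _).hasFDerivAt
  have h3 := h2.comp_hasDerivAt (0 : ℝ) ((hasDerivAt_line p p₁ 0).prodMk (hasDerivAt_line b b₁ 0))
  simpa using h3.unique h1

theorem fderiv_half_log_corrected {η : ℝ} (hη : 0 < η) (q : ℝ) (p b p₁ b₁ : V) :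
    fderiv ℝ (fun z : V × V => Real.log (η ^ 2 + ‖corrected η q z.1 z.2‖ ^ 2) / 2) (p, b) (p₁, b₁) =
      inner ℝ (corrected η q p b) (correctedDeriv η q p b p₁ b₁) /
        (η ^ 2 + ‖corrected η q p b‖ ^ 2) := by
  have h1 := hasDerivAt_half_log hη
    (hasDerivAt_corrected (q := q) hη (hasDerivAt_line p p₁ 0) (hasDerivAt_line b b₁ 0))
  have h2 : HasFDerivAt (fun z : V × V => Real.log (η ^ 2 + ‖corrected η q z.1 z.2‖ ^ 2) / 2) _
    (p + (0 : ℝ) • p₁, b + (0 : ℝ) • b₁) := (differentiable_half_log_corrected hη q _).hasFDerivAt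
  have h3 := h2.comp_hasDerivAt (0 : ℝ) ((hasDerivAt_line p p₁ 0).prodMk (hasDerivAt_line b b₁ 0))
  simpa using h3.unique h1

/-- The conditions satisfied at a boundary maximum bound the multiplier `K`. -/
theorem multiplier_le {p b ν : V} {η q B K δ φ : ℝ} (hL : Large η q B p) (hK : 0 ≤ K)
    {A b' Y' : V →L[ℝ] V} {h' : V →L[ℝ] ℝ} (hA : ∀ a c, inner ℝ (A a) c = inner ℝ a (A c))
    (hν : ‖ν‖ = 1) (hb : b = φ • ν) (hbB : ‖b‖ ≤ B) (hb' : ∀ ω, ‖b' ω‖ ≤ B * ‖ω‖)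
    (hY' : ∀ ω, ‖Y' ω‖ ≤ B * ‖ω‖) (hP : inner ℝ (corrected η q p b) ν = 0)
    (hh : h' ν ≤ -δ) (hhτ : ∀ τ, inner ℝ τ ν = 0 → h' τ = 0)
    (hmax : ∀ ω, inner ℝ ω ν < 0 → inner ℝ (corrected η q p b)
      (correctedDeriv η q p b (A ω) (b' ω)) / (η ^ 2 + ‖corrected η q p b‖ ^ 2) + K * h' ω ≤ 0)
    (hbdry : ∀ τ, inner ℝ τ ν = 0 → inner ℝ (correctedDeriv η q p b (A τ) (b' τ)) ν +
      inner ℝ (corrected η q p b) (Y' τ) = 0) :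
    K * δ ≤ 3 + 18 * B := by
  have hη := hL.pos
  have hE := (hL.energy_bounds hbB).1
  have hv : 0 < √(η ^ 2 + ‖p‖ ^ 2) := by linarith [hL.two_le]
  have hEpos : 0 < η ^ 2 + ‖corrected η q p b‖ ^ 2 := by positivity
  have hφ : |φ| ≤ B := by simpa [hb, norm_smul, hν] using hbB
  have hPn := hL.norm_corrected_le hbB
  have hp : p = corrected η q p b + (√(η ^ 2 + ‖p‖ ^ 2) * √(η ^ 2 + ‖p‖ ^ 2) ^ (-q) * φ) • ν := by
    rw [corrected, hL.rpow_eq]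
    conv_rhs => enter [1, 2, 2]; rw [hb]
    rw [smul_smul]; abel
  set P := corrected η q p b with hPdef
  have hPb : inner ℝ P b = 0 := by rw [hb, inner_smul_right, hP, mul_zero]
  -- `L` is the differential of the spatial part of the auxiliary function; the term containing `b`
  -- has vanished because P is tangential and `b` is normal.
  let L : V →L[ℝ] ℝ := (η ^ 2 + ‖P‖ ^ 2)⁻¹ •
    ((innerSL ℝ P).comp (A - (√(η ^ 2 + ‖p‖ ^ 2) ^ (1 - q)) • b')) + K • h'
  have hPd : ∀ ω, inner ℝ P (correctedDeriv η q p b (A ω) (b' ω)) =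
      inner ℝ P (A ω) - √(η ^ 2 + ‖p‖ ^ 2) ^ (1 - q) * inner ℝ P (b' ω) := by
    intro ω
    rw [correctedDeriv, inner_sub_right, inner_sub_right, inner_smul_right, inner_smul_right, hPb]
    ring
  have hLval : ∀ ω, L ω = (inner ℝ P (A ω) -
      √(η ^ 2 + ‖p‖ ^ 2) ^ (1 - q) * inner ℝ P (b' ω)) / (η ^ 2 + ‖P‖ ^ 2) + K * h' ω := by
    intro ω
    simp [L, div_eq_inv_mul]
  have hLneg : ∀ ω, inner ℝ ω ν < 0 → L ω ≤ 0 := by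
    intro ω hω
    rw [hLval, ← hPd]; exact hmax ω hω
  have hLν : 0 ≤ L ν := by
    have := hLneg (-ν) (by simp [inner_neg_left, hν])
    rw [map_neg] at this; linarith
  -- A tangential τ is a limit of the strictly inward vectors τ − εν.
  have hLle : ∀ τ, inner ℝ τ ν = 0 → L τ ≤ 0 := by
    intro τ hτ
    have h1 : ∀ᶠ ε in 𝓝[>] (0 : ℝ), L τ - ε * L ν ≤ 0 := by
      filter_upwards [self_mem_nhdsWithin] with ε hε
      have hε' : 0 < ε := hε
      have := hLneg (τ - ε • ν)
        (by rw [inner_sub_left, hτ, inner_smul_left, real_inner_self_eq_norm_sq, hν]; simpa)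
      simpa using this
    have h2 : Tendsto (fun ε : ℝ => L τ - ε * L ν) (𝓝[>] 0) (𝓝 (L τ - 0 * L ν)) :=
      Tendsto.mono_left (by fun_prop : Continuous fun ε : ℝ => L τ - ε * L ν).continuousAt
        nhdsWithin_le_nhds
    have := le_of_tendsto h2 h1
    linarith
  have hLP : L P = 0 := by
    refine le_antisymm (hLle P hP) ?_
    have := hLle (-P) (by rw [inner_neg_left, hP, neg_zero])
    rw [map_neg] at this; linarith
  rw [hLval, hhτ P hP, mul_zero, add_zero, div_eq_zero_iff, or_iff_left hEpos.ne', hL.rpow_eq,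
    sub_eq_zero] at hLP
  have hB := hbdry P hP
  rw [correctedDeriv, inner_sub_left, inner_sub_left, inner_smul_left, inner_smul_left, hL.rpow_eq]
    at hB
  have hbν : inner ℝ b ν = φ := by
    rw [hb, inner_smul_left, real_inner_self_eq_norm_sq, hν]; simp
  -- Stationarity along P gives P · AP; splitting p into P and its normal correction then expresses
  -- p · AP through z = AP · ν.
  have hpA : inner ℝ p (A P) = √(η ^ 2 + ‖p‖ ^ 2) * √(η ^ 2 + ‖p‖ ^ 2) ^ (-q) *
      (inner ℝ P (b' P) + φ * inner ℝ (A P) ν) := by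
    conv_lhs => rw [hp]
    rw [inner_add_left, inner_smul_left, hLP, real_inner_comm (A P) ν]
    simp only [conj_trivial]; ring
  rw [hpA, hbν] at hB
  simp only [conj_trivial] at hB
  rw [hLval, hL.rpow_eq, ← hA P ν] at hLν
  have c1 : |inner ℝ P (b' P)| ≤ 2 * √(η ^ 2 + ‖p‖ ^ 2) * (B * (2 * √(η ^ 2 + ‖p‖ ^ 2))) :=
    (abs_real_inner_le_norm _ _).trans (mul_le_mul hPn ((hb' P).trans
      (mul_le_mul_of_nonneg_left hPn hL.B_nonneg)) (norm_nonneg _) (by positivity))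
  have c2 : |inner ℝ (b' P) ν| ≤ B * (2 * √(η ^ 2 + ‖p‖ ^ 2)) := by
    refine (abs_real_inner_le_norm _ _).trans ?_
    rw [hν, mul_one]
    exact (hb' P).trans (mul_le_mul_of_nonneg_left hPn hL.B_nonneg)
  have c3 : |inner ℝ P (Y' P)| ≤ 2 * √(η ^ 2 + ‖p‖ ^ 2) * (B * (2 * √(η ^ 2 + ‖p‖ ^ 2))) :=
    (abs_real_inner_le_norm _ _).trans (mul_le_mul hPn ((hY' P).trans
      (mul_le_mul_of_nonneg_left hPn hL.B_nonneg)) (norm_nonneg _) (by positivity))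
  have c4 : |inner ℝ P (b' ν)| ≤ 2 * √(η ^ 2 + ‖p‖ ^ 2) * B := by
    refine (abs_real_inner_le_norm _ _).trans
      (mul_le_mul hPn ?_ (norm_nonneg _) (by positivity))
    simpa [hν] using hb' ν
  have m1 := hL.mul_le
  have m2 := hL.abs_mul_le
  have m3 := hL.rpow_pos
  have m4 := hL.B_nonneg
  clear_value P L
  generalize √(η ^ 2 + ‖p‖ ^ 2) = v at *
  generalize v ^ (-q) = θ at *
  generalize inner ℝ P (b' P) = y₁ at *
  generalize inner ℝ (b' P) ν = y₂ at *
  generalize inner ℝ P (Y' P) = y₃ at *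
  generalize inner ℝ P (b' ν) = y₄ at *
  generalize inner ℝ (A P) ν = z at *
  generalize η ^ 2 + ‖P‖ ^ 2 = E at *
  have hθφ : |θ * φ| ≤ 1 / 100 := by
    rw [abs_mul, abs_of_pos m3]; exact (mul_le_mul_of_nonneg_left hφ m3.le).trans m1
  have hkθφ : |(1 - q) * (θ * φ)| ≤ 1 / 100 := by
    rw [abs_mul, abs_mul, abs_of_pos m3]
    exact (mul_le_mul_of_nonneg_left (mul_le_mul_of_nonneg_left hφ m3.le) (abs_nonneg _)).trans m2
  have hk2 : |(1 - q) * (θ * φ) * (θ * φ)| ≤ 1 / 100 * (1 / 100) := by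
    rw [abs_mul]; gcongr
  have hθy1 : |θ * y₁| ≤ v ^ 2 / 25 := by
    rw [abs_mul, abs_of_pos m3]
    calc _ ≤ θ * (2 * v * (B * (2 * v))) := by gcongr
      _ = 4 * v ^ 2 * (θ * B) := by ring
      _ ≤ 4 * v ^ 2 * (1 / 100) := by gcongr
      _ = _ := by ring
  have r1 : |(1 - q) * (θ * φ) * (θ * y₁)| ≤ v ^ 2 / 2500 := by
    rw [abs_mul]
    calc _ ≤ 1 / 100 * (v ^ 2 / 25) := by gcongr
      _ = _ := by ring
  have r2 : |v * θ * y₂| ≤ v ^ 2 / 50 := by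
    rw [abs_mul, abs_mul, abs_of_pos hv, abs_of_pos m3]
    calc _ ≤ v * θ * (B * (2 * v)) := by gcongr
      _ = 2 * v ^ 2 * (θ * B) := by ring
      _ ≤ 2 * v ^ 2 * (1 / 100) := by gcongr
      _ = _ := by ring
  have r4 : |v * θ * y₄| ≤ v ^ 2 / 50 := by
    rw [abs_mul, abs_mul, abs_of_pos hv, abs_of_pos m3]
    calc _ ≤ v * θ * (2 * v * B) := by gcongr
      _ = 2 * v ^ 2 * (θ * B) := by ring
      _ ≤ 2 * v ^ 2 * (1 / 100) := by gcongr
      _ = _ := by ring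
  -- The differentiated boundary identity becomes a scalar linear equation for z, with coefficient
  -- at least 99/100. By symmetry z is also P · Aν, the quantity in `L ν ≥ 0`.
  have hz : z * (1 - (1 - q) * (θ * φ) * (θ * φ)) =
      (1 - q) * (θ * φ) * (θ * y₁) + v * θ * y₂ - y₃ := by
    have : v * θ * (y₁ + φ * z) / v = θ * (y₁ + φ * z) := by field_simp
    rw [this] at hB
    linarith
  rw [abs_le] at r1 r2 r4 hk2 c3
  have hz1 : z * (1 - (1 - q) * (θ * φ) * (θ * φ)) ≤ v ^ 2 / 40 + 4 * B * v ^ 2 := by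
    rw [hz]; linarith [sq_nonneg v]
  have hz2 : z ≤ v ^ 2 / 30 + 5 * B * v ^ 2 := by
    by_contra! hcon
    have hz0 : 0 ≤ z := hcon.le.trans' (by positivity)
    have : z * (1 - 1 / 100) ≤ z * (1 - (1 - q) * (θ * φ) * (θ * φ)) :=
      mul_le_mul_of_nonneg_left (by linarith) hz0
    have : 0 ≤ B * v ^ 2 := by positivity
    linarith [sq_nonneg v]
  have hfrac : (z - v * θ * y₄) / E ≤ 3 + 18 * B := by
    rw [div_le_iff₀ (by linarith)]
    have : (3 + 18 * B) * (v ^ 2 / 2) ≤ (3 + 18 * B) * E := by gcongr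
    have : 0 ≤ B * v ^ 2 := by positivity
    linarith [sq_nonneg v]
  have := mul_le_mul_of_nonneg_left hh hK
  linarith

end

/-! ### Normals and tangent cones of a C^k domain. -/

section

theorem inter_frontier_nonempty_of_isPreconnected {X : Type*} [TopologicalSpace X]
    {s t : Set X} (hs : IsPreconnected s) (h1 : (s ∩ t).Nonempty) (h2 : (s ∩ tᶜ).Nonempty) :
    (s ∩ frontier t).Nonempty := by
  by_contra! hcon
  have hnot : ∀ y ∈ s, y ∉ frontier t := fun y hy hyf => by
    have : y ∈ s ∩ frontier t := ⟨hy, hyf⟩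
    rw [hcon] at this; exact this
  obtain ⟨y1, hy1, hy1t⟩ := h1
  obtain ⟨y2, hy2, hy2t⟩ := h2
  obtain ⟨y, -, hyi, hyc⟩ := hs (interior t) (closure t)ᶜ isOpen_interior
    isClosed_closure.isOpen_compl
    (fun y hy => by
      by_cases hc : y ∈ closure t
      · left; by_contra hi; exact hnot y hy ⟨hc, hi⟩
      · right; exact hc)
    ⟨y1, hy1, by by_contra hi; exact hnot y1 hy1 ⟨subset_closure hy1t, hi⟩⟩
    ⟨y2, hy2, fun hc => hnot y2 hy2 ⟨hc, fun hi => hy2t (interior_subset hi)⟩⟩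
  exact hyc (subset_closure (interior_subset hyi))

variable {n : ℕ} {Ω U : Set (EuclideanSpace ℝ (Fin n))} {g : EuclideanSpace ℝ (Fin n) → ℝ}
  {x ν : EuclideanSpace ℝ (Fin n)} {k : ℕ}

theorem IsDefiningFunction.eq_zero (hg : IsDefiningFunction k Ω U g) (hΩ : IsOpen Ω)
    (hxU : x ∈ U) (hx : x ∈ frontier Ω) : g x = 0 := by
  have hxΩ : x ∉ Ω := fun h => by rw [hΩ.frontier_eq] at hx; exact hx.2 h
  apply le_antisymm
  · by_contra! hpos
    have hc : ContinuousAt g x :=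
      hg.contDiffOn.continuousOn.continuousAt (hg.isOpen.mem_nhds hxU)
    have h1 : ∀ᶠ y in 𝓝 x, 0 < g y ∧ y ∈ U :=
      (hc.eventually (lt_mem_nhds hpos)).and (hg.isOpen.mem_nhds hxU)
    obtain ⟨y, ⟨hy1, hy2⟩, hy3⟩ :=
      (h1.and_frequently (mem_closure_iff_frequently.1 (frontier_subset_closure hx))).exists
    have : y ∈ Ω ∩ U := ⟨hy3, hy2⟩
    rw [hg.inter_eq] at this
    exact absurd this.2 (not_lt.2 hy1.le)
  · by_contra! hneg
    have : x ∈ {y ∈ U | g y < 0} := ⟨hxU, hneg⟩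
    rw [← hg.inter_eq] at this
    exact hxΩ this.1

theorem IsDefiningFunction.hasGradientAt (hg : IsDefiningFunction k Ω U g) (hk : 1 ≤ k)
    (hxU : x ∈ U) : HasGradientAt g (gradient g x) x := by
  have h1 : ContDiffAt ℝ k g x := hg.contDiffOn.contDiffAt (hg.isOpen.mem_nhds hxU)
  exact (h1.differentiableAt (by simp; omega)).hasGradientAt

theorem IsDefiningFunction.eventually_sign (hg : IsDefiningFunction k Ω U g) (hk : 1 ≤ k)
    (hΩ : IsOpen Ω) (hxU : x ∈ U) (hx : x ∈ frontier Ω) (ω : EuclideanSpace ℝ (Fin n)) :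
    (inner ℝ ω (gradient g x) < 0 → ∀ᶠ s : ℝ in 𝓝[>] 0, x + s • ω ∈ Ω) ∧
    (0 < inner ℝ ω (gradient g x) → ∀ᶠ s : ℝ in 𝓝[>] 0, x + s • ω ∉ Ω) := by
  have h0 := hg.eq_zero hΩ hxU hx
  have h1 : HasFDerivAt g (InnerProductSpace.toDual ℝ _ (gradient g x)) (x + (0 : ℝ) • ω) := by
    simpa using (hg.hasGradientAt hk hxU).hasFDerivAt
  have h2 := (h1.comp_hasDerivAt (0 : ℝ) (hasDerivAt_line x ω 0)).deriv
  simp only [InnerProductSpace.toDual_apply_apply] at h2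
  have h3 : (g ∘ fun r : ℝ => x + r • ω) 0 = 0 := by simpa using h0
  have hU : ∀ᶠ s : ℝ in 𝓝 0, x + s • ω ∈ U := by
    have : Continuous fun s : ℝ => x + s • ω := by fun_prop
    exact this.continuousAt.eventually_mem (hg.isOpen.mem_nhds (by simpa using hxU))
  rw [real_inner_comm] at h2
  constructor
  · intro h
    have h4 := eventually_nhdsWithin_sign_eq_of_deriv_neg (by rw [h2]; exact h) h3
    filter_upwards [h4.filter_mono nhdsWithin_le_nhds, self_mem_nhdsWithin,
      hU.filter_mono nhdsWithin_le_nhds] with s hs1 hs2 hs3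
    rw [sign_neg (sub_neg.2 hs2), sign_eq_neg_one_iff] at hs1
    have : x + s • ω ∈ Ω ∩ U := by rw [hg.inter_eq]; exact ⟨hs3, hs1⟩
    exact this.1
  · intro h
    have h4 := eventually_nhdsWithin_sign_eq_of_deriv_pos (by rw [h2]; exact h) h3
    filter_upwards [h4.filter_mono nhdsWithin_le_nhds, self_mem_nhdsWithin,
      hU.filter_mono nhdsWithin_le_nhds] with s hs1 hs2 hs3
    rw [sign_pos (sub_pos.2 hs2), sign_eq_one_iff] at hs1
    intro hs4
    have : x + s • ω ∈ Ω ∩ U := ⟨hs4, hs3⟩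
    rw [hg.inter_eq] at this
    exact absurd this.2 (not_lt.2 (le_of_lt hs1))

theorem IsOutwardUnitNormal.norm_eq_one (hν : IsOutwardUnitNormal Ω x ν) : ‖ν‖ = 1 := by
  obtain ⟨-, U, g, hxU, hg, rfl⟩ := hν
  exact norm_smul_inv_norm (𝕜 := ℝ) (hg.gradient_ne_zero x hxU)

theorem IsOutwardUnitNormal.eventually_mem (hν : IsOutwardUnitNormal Ω x ν) (hΩ : IsOpen Ω)
    {ω : EuclideanSpace ℝ (Fin n)} (hω : inner ℝ ω ν < 0) :
    ∀ᶠ s : ℝ in 𝓝[>] 0, x + s • ω ∈ Ω := by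
  obtain ⟨hx, U, g, hxU, hg, rfl⟩ := hν
  refine (hg.eventually_sign le_rfl hΩ hxU hx ω).1 ?_
  have : 0 < ‖gradient g x‖⁻¹ := by have := hg.gradient_ne_zero x hxU; positivity
  rw [inner_smul_right] at hω
  exact neg_of_mul_neg_right hω this.le

theorem IsOutwardUnitNormal.eventually_notMem (hν : IsOutwardUnitNormal Ω x ν) (hΩ : IsOpen Ω)
    {ω : EuclideanSpace ℝ (Fin n)} (hω : 0 < inner ℝ ω ν) :
    ∀ᶠ s : ℝ in 𝓝[>] 0, x + s • ω ∉ Ω := by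
  obtain ⟨hx, U, g, hxU, hg, rfl⟩ := hν
  refine (hg.eventually_sign le_rfl hΩ hxU hx ω).2 ?_
  have : 0 < ‖gradient g x‖⁻¹ := by have := hg.gradient_ne_zero x hxU; positivity
  rw [inner_smul_right] at hω
  exact pos_of_mul_pos_right hω this.le

/-- If the unit normals α and ν of two defining functions differed, the vector α − ν would point
into Ω according to one and out of Ω according to the other. -/
theorem IsOutwardUnitNormal.gradient_eq (hν : IsOutwardUnitNormal Ω x ν) (hΩ : IsOpen Ω)
    (hg : IsDefiningFunction k Ω U g) (hk : 1 ≤ k) (hxU : x ∈ U) :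
    gradient g x = ‖gradient g x‖ • ν := by
  have hne := hg.gradient_ne_zero x hxU
  have hn := hν.norm_eq_one
  set α := ‖gradient g x‖⁻¹ • gradient g x with hα
  have hαn : ‖α‖ = 1 := norm_smul_inv_norm (𝕜 := ℝ) hne
  have hga : gradient g x = ‖gradient g x‖ • α := by
    rw [hα, smul_smul, mul_inv_cancel₀ (norm_ne_zero_iff.2 hne), one_smul]
  suffices α = ν by rw [← this]; exact hga
  by_contra hne'
  have hlt : inner ℝ α ν < 1 := by
    have h1 := norm_sub_sq_real α ν
    have h2 : 0 < ‖α - ν‖ := norm_pos_iff.2 (sub_ne_zero.2 hne')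
    rw [hαn, hn] at h1
    nlinarith
  have h1 : inner ℝ (α - ν) ν < 0 := by
    rw [inner_sub_left, real_inner_self_eq_norm_sq, hn]; linarith
  have h2 : 0 < inner ℝ (α - ν) (gradient g x) := by
    rw [hga, inner_smul_right, inner_sub_left, real_inner_self_eq_norm_sq, hαn,
      real_inner_comm ]
    exact mul_pos (norm_pos_iff.2 hne) (by linarith)
  obtain ⟨s, hs1, hs2⟩ := ((hν.eventually_mem hΩ h1).and
    ((hg.eventually_sign hk hΩ hxU hν.1 _).2 h2)).exists
  exact hs2 hs1

theorem IsBoundedDomainOfClass.exists_normal (hΩ : IsBoundedDomainOfClass k Ω) (hk : 1 ≤ k)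
    (hx : x ∈ frontier Ω) : ∃ ν, IsOutwardUnitNormal Ω x ν := by
  obtain ⟨U, g, hxU, hg⟩ := hΩ.boundary x hx
  exact ⟨_, hx, U, g, hxU, ⟨hg.isOpen, hg.contDiffOn.of_le (by exact_mod_cast hk),
    hg.gradient_ne_zero, hg.inter_eq⟩, rfl⟩

theorem IsOutwardUnitNormal.mem_posTangentConeAt (hν : IsOutwardUnitNormal Ω x ν) (hΩ : IsOpen Ω)
    {ω : EuclideanSpace ℝ (Fin n)} (hω : inner ℝ ω ν < 0) :
    ω ∈ posTangentConeAt (closure Ω) x :=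
  mem_posTangentConeAt_of_frequently_mem
    ((hν.eventually_mem hΩ hω).mono fun _ hs => subset_closure hs).frequently

/-- For small s the segment from x + s(τ − εν) to x + s(τ + εν) starts in Ω and ends outside, so it
meets the frontier. Letting ε → 0 produces boundary points approaching x in direction τ, without the
implicit function theorem. -/
theorem IsOutwardUnitNormal.mem_tangentConeAt_frontier (hν : IsOutwardUnitNormal Ω x ν)
    (hΩ : IsOpen Ω) {τ : EuclideanSpace ℝ (Fin n)} (hτ : inner ℝ τ ν = 0) :
    τ ∈ tangentConeAt ℝ (frontier Ω) x := by
  have hn := hν.norm_eq_one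
  have key : ∀ ε : ℝ, 0 < ε → ∃ s r : ℝ, 0 < s ∧ s < ε ∧ |r| ≤ ε ∧
      x + s • (τ + r • ν) ∈ frontier Ω := by
    intro ε hε
    have h1 : inner ℝ (τ + (-ε) • ν) ν < 0 := by
      rw [inner_add_left, hτ, inner_smul_left, real_inner_self_eq_norm_sq, hn]; simpa
    have h2 : 0 < inner ℝ (τ + ε • ν) ν := by
      rw [inner_add_left, hτ, inner_smul_left, real_inner_self_eq_norm_sq, hn]; simpa
    obtain ⟨s, ⟨hs1, hs2⟩, hs3⟩ := (((hν.eventually_mem hΩ h1).and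
      (hν.eventually_notMem hΩ h2)).and (Ioo_mem_nhdsGT hε)).exists
    have hpre : IsPreconnected ((fun r : ℝ => x + s • (τ + r • ν)) '' Icc (-ε) ε) :=
      isPreconnected_Icc.image _ (by fun_prop)
    obtain ⟨_, ⟨r, hr, rfl⟩, hf⟩ := inter_frontier_nonempty_of_isPreconnected hpre
      ⟨_, ⟨-ε, ⟨le_rfl, by linarith⟩, rfl⟩, hs1⟩ ⟨_, ⟨ε, ⟨by linarith, le_rfl⟩, rfl⟩, hs2⟩
    exact ⟨s, r, hs3.1, hs3.2, abs_le.2 hr, hf⟩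
  choose s r hs0 hs hr hf using fun m : ℕ => key (1 / ((m : ℝ) + 1)) Nat.one_div_pos_of_nat
  have hlim := tendsto_one_div_add_atTop_nhds_zero_nat (𝕜 := ℝ)
  have hs' : Tendsto s atTop (𝓝 0) :=
    squeeze_zero (fun m => (hs0 m).le) (fun m => (hs m).le) hlim
  have hr' : Tendsto r atTop (𝓝 0) := squeeze_zero_norm hr hlim
  have hω : Tendsto (fun m => τ + r m • ν) atTop (𝓝 (τ + (0 : ℝ) • ν)) :=
    tendsto_const_nhds.add (hr'.smul_const ν)
  refine mem_tangentConeAt_of_seq atTop (fun m => (s m)⁻¹) (fun m => s m • (τ + r m • ν))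
    (by simpa using hs'.smul hω) (Eventually.of_forall hf) ?_
  have : ∀ m, (s m)⁻¹ • s m • (τ + r m • ν) = τ + r m • ν := fun m =>
    inv_smul_smul₀ (hs0 m).ne' _
  simp only [this]
  simpa using hω

theorem IsBoundedDomainOfClass.uniqueDiffOn (hΩ : IsBoundedDomainOfClass k Ω) (hk : 1 ≤ k) :
    UniqueDiffOn ℝ (closure Ω) := by
  intro x hx
  by_cases hxΩ : x ∈ Ω
  · exact (hΩ.isOpen.uniqueDiffWithinAt hxΩ).mono subset_closure
  · obtain ⟨ν, hν⟩ := hΩ.exists_normal hk (x := x)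
      (by rw [hΩ.isOpen.frontier_eq]; exact ⟨hx, hxΩ⟩)
    refine ⟨?_, subset_closure hx⟩
    -- The tangent cone contains the open half-space of inward vectors, and a subspace with nonempty
    -- interior is the whole space.
    have hopen : IsOpen {ω : EuclideanSpace ℝ (Fin n) | inner ℝ ω ν < 0} :=
      isOpen_lt (by fun_prop) continuous_const
    have hsub : {ω : EuclideanSpace ℝ (Fin n) | inner ℝ ω ν < 0} ⊆
        (Submodule.span ℝ (tangentConeAt ℝ (closure Ω) x) : Set _) := fun ω hω =>
      Submodule.subset_span (mem_tangentConeAt_of_seq (𝓝[>] (0 : ℝ)) (fun s => s⁻¹)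
        (fun s => s • ω)
        (by
          have : Continuous fun s : ℝ => s • ω := by fun_prop
          simpa using (this.tendsto 0).mono_left nhdsWithin_le_nhds)
        ((hν.eventually_mem hΩ.isOpen hω).mono fun s hs => subset_closure hs)
        (tendsto_const_nhds.congr' (by
          filter_upwards [self_mem_nhdsWithin] with s hs
          exact (inv_smul_smul₀ (ne_of_gt hs) ω).symm)))
    have htop := (Submodule.span ℝ (tangentConeAt ℝ (closure Ω) x)).eq_top_of_nonempty_interior'
      ⟨-ν, interior_mono hsub (by
        rw [hopen.interior_eq]
        simp [inner_neg_left, hν.norm_eq_one])⟩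
    rw [htop]
    exact dense_univ

end

/-! ### The boundary weight, the extended normal, and uniform derivative bounds. -/

section

variable {n : ℕ} {Ω : Set (EuclideanSpace ℝ (Fin n))}

/-- The weight is a cutoff times a defining function. As the defining function vanishes on ∂Ω, the
derivative of the cutoff does not contribute there, and the multiple of the normal is nonnegative
everywhere. Such weights can therefore be added over a finite cover. -/
theorem IsBoundedDomainOfClass.exists_local_weight (hΩ : IsBoundedDomainOfClass 3 Ω)
    {x : EuclideanSpace ℝ (Fin n)} (hx : x ∈ frontier Ω) :
    ∃ w : EuclideanSpace ℝ (Fin n) → ℝ, ∃ N ∈ 𝓝 x, ContDiff ℝ 3 w ∧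
      ∀ y ∈ frontier Ω, ∀ ν, IsOutwardUnitNormal Ω y ν →
        ∃ c : ℝ, 0 ≤ c ∧ fderiv ℝ w y = c • innerSL ℝ ν ∧ (y ∈ N → 0 < c) := by
  obtain ⟨U, g, hxU, hg⟩ := hΩ.boundary x hx
  obtain ⟨r, hr, hball⟩ := Metric.nhds_basis_closedBall.mem_iff.1 (hg.isOpen.mem_nhds hxU)
  let χ : ContDiffBump x := ⟨r / 2, r, by linarith, by linarith⟩
  have hzero : ∀ y ∉ U, χ =ᶠ[𝓝 y] 0 := fun y hy => by
    refine notMem_tsupport_iff_eventuallyEq.1 fun h => hy ?_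
    rw [χ.tsupport_eq] at h
    exact hball h
  refine ⟨fun y => χ y * g y, Metric.ball x r, Metric.ball_mem_nhds x hr, ?_, ?_⟩
  · refine contDiff_iff_contDiffAt.2 fun y => ?_
    by_cases hy : y ∈ U
    · exact χ.contDiffAt.mul (hg.contDiffOn.contDiffAt (hg.isOpen.mem_nhds hy))
    · refine contDiffAt_const (c := (0 : ℝ)) |>.congr_of_eventuallyEq ?_
      filter_upwards [hzero y hy] with z hz
      rw [hz]; simp
  · intro y hy ν hν
    by_cases hyU : y ∈ U
    · have h1 := hg.hasGradientAt (by norm_num) hyU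
      have h2 : HasFDerivAt χ (fderiv ℝ χ y) y :=
        (χ.contDiffAt.differentiableAt (n := 1) (by simp)).hasFDerivAt
      have h3 := (h2.mul h1.hasFDerivAt).fderiv
      refine ⟨χ y * ‖gradient g y‖, mul_nonneg χ.nonneg (norm_nonneg _), ?_, fun hyN =>
        mul_pos (χ.pos_of_mem_ball hyN) (norm_pos_iff.2 (hg.gradient_ne_zero y hyU))⟩
      refine h3.trans ?_
      rw [hg.eq_zero hΩ.isOpen hyU hy, zero_smul, add_zero]
      conv_lhs => rw [hν.gradient_eq hΩ.isOpen hg (by norm_num) hyU]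
      ext z
      simp [mul_assoc]
    · refine ⟨0, le_rfl, ?_, fun h => absurd (hball (Metric.ball_subset_closedBall h)) hyU⟩
      have : (fun y => χ y * g y) =ᶠ[𝓝 y] fun _ => 0 := by
        filter_upwards [hzero y hyU] with z hz
        rw [hz]; simp
      rw [this.fderiv_eq]; simp

/-- A global function whose differential on the boundary is a positive multiple of the normal. -/
theorem IsBoundedDomainOfClass.exists_weight (hΩ : IsBoundedDomainOfClass 3 Ω) :
    ∃ ρ : EuclideanSpace ℝ (Fin n) → ℝ, ContDiff ℝ 3 ρ ∧ ∃ δ : ℝ, 0 < δ ∧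
      ∀ y ∈ frontier Ω, ∀ ν, IsOutwardUnitNormal Ω y ν →
        ∃ c : ℝ, δ ≤ c ∧ fderiv ℝ ρ y = c • innerSL ℝ ν := by
  have hcpt : IsCompact (frontier Ω) :=
    hΩ.isBounded.isCompact_closure.of_isClosed_subset isClosed_frontier frontier_subset_closure
  choose! w N hN hw hwd using fun x (hx : x ∈ frontier Ω) => hΩ.exists_local_weight hx
  obtain ⟨F, hF, hcov⟩ := hcpt.elim_nhds_subcover N hN
  have hcd : ContDiff ℝ 3 (fun y => ∑ x ∈ F, w x y) := ContDiff.sum fun x hx => hw x (hF x hx)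
  have hpos : ∀ y ∈ frontier Ω, ∀ ν, IsOutwardUnitNormal Ω y ν →
        ∃ c : ℝ, 0 < c ∧ fderiv ℝ (fun y => ∑ x ∈ F, w x y) y = c • innerSL ℝ ν := by
    intro y hy ν hν
    have h1 : ∀ x, ∃ c : ℝ, x ∈ F → 0 ≤ c ∧ fderiv ℝ (w x) y = c • innerSL ℝ ν ∧
        (y ∈ N x → 0 < c) := fun x => by
      by_cases hx : x ∈ F
      · obtain ⟨c, hc⟩ := hwd x (hF x hx) y hy ν hν
        exact ⟨c, fun _ => hc⟩
      · exact ⟨0, fun h => absurd h hx⟩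
    choose c hc using h1
    refine ⟨∑ x ∈ F, c x, ?_, ?_⟩
    · obtain ⟨x, hx, hyx⟩ := mem_iUnion₂.1 (hcov hy)
      exact Finset.sum_pos' (fun z hz => (hc z hz).1) ⟨x, hx, (hc x hx).2.2 hyx⟩
    · rw [fderiv_fun_sum fun x hx => (hw x (hF x hx)).differentiable (by simp) y, Finset.sum_smul]
      exact Finset.sum_congr rfl fun x hx => (hc x hx).2.1
  refine ⟨_, hcd, ?_⟩
  have hcont : Continuous fun y => ‖fderiv ℝ (fun y => ∑ x ∈ F, w x y) y‖ :=
    (hcd.continuous_fderiv (by simp)).norm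
  obtain ⟨δ, hδ, hle⟩ := hcpt.exists_forall_le' (a := 0) hcont.continuousOn fun y hy => by
    obtain ⟨ν, hν⟩ := hΩ.exists_normal (by norm_num) hy
    obtain ⟨c, hc, h⟩ := hpos y hy ν hν
    rw [h, norm_smul, innerSL_apply_norm, hν.norm_eq_one]
    simpa using hc.ne'
  refine ⟨δ, hδ, fun y hy ν hν => ?_⟩
  obtain ⟨c, hc, h⟩ := hpos y hy ν hν
  refine ⟨c, ?_, h⟩
  have := hle y hy
  rw [h, norm_smul, innerSL_apply_norm, hν.norm_eq_one, mul_one, Real.norm_of_nonneg hc.le] at this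
  exact this

/-- A `C²` extension of the normal. -/
theorem exists_normal_extension {ρ : EuclideanSpace ℝ (Fin n) → ℝ} (hρ : ContDiff ℝ 3 ρ) {δ : ℝ}
    (hδ : 0 < δ) (h : ∀ y ∈ frontier Ω, ∀ ν, IsOutwardUnitNormal Ω y ν →
        ∃ c : ℝ, δ ≤ c ∧ fderiv ℝ ρ y = c • innerSL ℝ ν)
    (hex : ∀ y ∈ frontier Ω, ∃ ν, IsOutwardUnitNormal Ω y ν) :
    ∃ Y : EuclideanSpace ℝ (Fin n) → EuclideanSpace ℝ (Fin n), ContDiff ℝ 2 Y ∧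
      ∀ y ∈ frontier Ω, ∀ ν, IsOutwardUnitNormal Ω y ν → Y y = ν := by
  -- The function κ ≥ 0 vanishes exactly on ∂Ω. Adding it under the root keeps the normalisation of
  -- Dρ smooth where Dρ may vanish, and leaves it unchanged on ∂Ω.
  obtain ⟨κ, hκs, hκ, hκr⟩ := (isClosed_frontier (s := Ω)).isOpen_compl.exists_contDiff_support_eq
    (n := 2)
  have hκ0 : ∀ y, 0 ≤ κ y := fun y => (hκr ⟨y, rfl⟩).1
  let D : EuclideanSpace ℝ (Fin n) → EuclideanSpace ℝ (Fin n) :=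
    fun y => (InnerProductSpace.toDual ℝ _).symm (fderiv ℝ ρ y)
  have hD : ContDiff ℝ 2 D :=
    (InnerProductSpace.toDual ℝ (EuclideanSpace ℝ (Fin n))).symm.contDiff.comp
      (hρ.fderiv_right (by norm_num))
  have hDν : ∀ y ∈ frontier Ω, ∀ ν, IsOutwardUnitNormal Ω y ν → ∃ c : ℝ, 0 < c ∧ D y = c • ν := by
    intro y hy ν hν
    obtain ⟨c, hc, hc'⟩ := h y hy ν hν
    refine ⟨c, hδ.trans_le hc, ?_⟩
    simp only [D, hc', map_smul]
    congr 1
    exact (InnerProductSpace.toDual ℝ _).symm_apply_apply ν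
  have hpos : ∀ y, 0 < ‖D y‖ ^ 2 + κ y := by
    intro y
    by_cases hy : y ∈ frontier Ω
    · obtain ⟨ν, hν⟩ := hex y hy
      obtain ⟨c, hc, hc'⟩ := hDν y hy ν hν
      have : 0 < ‖D y‖ := by
        rw [hc', norm_smul, hν.norm_eq_one, mul_one]; exact norm_pos_iff.2 hc.ne'
      have := hκ0 y
      positivity
    · have : y ∈ Function.support κ := by rw [hκs]; exact hy
      have := lt_of_le_of_ne (hκ0 y) (Ne.symm this)
      positivity
  refine ⟨fun y => (√(‖D y‖ ^ 2 + κ y))⁻¹ • D y, ?_, fun y hy ν hν => ?_⟩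
  · refine ContDiff.smul (ContDiff.inv (ContDiff.sqrt ?_ fun y => (hpos y).ne')
      fun y => (Real.sqrt_pos.2 (hpos y)).ne') hD
    exact (hD.norm_sq ℝ).add (by simpa using hκ)
  · obtain ⟨c, hc, hc'⟩ := hDν y hy ν hν
    have : κ y = 0 := by
      by_contra hne
      have : y ∈ Function.support κ := hne
      rw [hκs] at this
      exact this hy
    simp only [this, add_zero, Real.sqrt_sq (norm_nonneg _)]
    rw [hc', norm_smul, hν.norm_eq_one, mul_one, Real.norm_of_nonneg hc.le, smul_smul,
      inv_mul_cancel₀ hc.ne', one_smul]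

section Jet

variable {V W : Type*} [NormedAddCommGroup V] [InnerProductSpace ℝ V] [NormedAddCommGroup W]
  [NormedSpace ℝ W]

theorem JetBound.mono {B B' : ℝ} {G : V → W} {x : V} (h : JetBound B G x) (hB : B ≤ B') :
    JetBound B' G x :=
  ⟨h.contDiffAt, h.zero.trans hB, fun ω => (h.one ω).trans (by gcongr),
    fun ω => (h.two ω).trans (by gcongr)⟩

theorem exists_jetBound {S O : Set V} {G : V → W} (hS : IsCompact S) (hu : UniqueDiffOn ℝ S)
    (hO : IsOpen O) (hOS : O ⊆ S) (hG : ContDiffOn ℝ 2 G S) :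
    ∃ B : ℝ, (∀ x ∈ S, ‖G x‖ ≤ B ∧ ∀ ω, ‖fderivWithin ℝ G S x ω‖ ≤ B * ‖ω‖) ∧
      ∀ x ∈ O, JetBound B G x := by
  have h1 : ContDiffOn ℝ 1 (fderivWithin ℝ G S) S := hG.fderivWithin hu (by norm_num)
  have h2 : ContinuousOn (fderivWithin ℝ (fderivWithin ℝ G S) S) S :=
    h1.continuousOn_fderivWithin hu (by norm_num)
  obtain ⟨M0, hM0⟩ := hS.exists_bound_of_continuousOn hG.continuousOn
  obtain ⟨M1, hM1⟩ := hS.exists_bound_of_continuousOn h1.continuousOn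
  obtain ⟨M2, hM2⟩ : ∃ M, ∀ x ∈ S, ‖fderivWithin ℝ (fderivWithin ℝ G S) S x‖ ≤ M := by
    obtain ⟨M, hM⟩ := hS.exists_bound_of_continuousOn
      (ContinuousOn.norm (E := V →L[ℝ] V →L[ℝ] W) h2)
    exact ⟨M, fun x hx => (norm_norm _).symm.le.trans (hM x hx)⟩
  have e1 : ∀ x ∈ O, fderivWithin ℝ G S =ᶠ[𝓝 x] fderiv ℝ G := fun x hx => by
    filter_upwards [hO.mem_nhds hx] with y hy
    exact fderivWithin_of_mem_nhds (mem_of_superset (hO.mem_nhds hy) hOS)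
  have a0 := le_abs_self M0
  have a1 := le_abs_self M1
  have a2 := le_abs_self M2
  have b0 := abs_nonneg M0
  have b1 := abs_nonneg M1
  have b2 := abs_nonneg M2
  refine ⟨|M0| + 2 * |M1| + 4 * |M2|, fun x hx => ⟨(hM0 x hx).trans (by linarith), fun ω =>
    ((fderivWithin ℝ G S x).le_of_opNorm_le (hM1 x hx) ω).trans ?_⟩, fun x hx => ⟨?_, ?_, ?_, ?_⟩⟩
  · gcongr; linarith
  · exact hG.contDiffAt (mem_of_superset (hO.mem_nhds hx) hOS)
  · exact (hM0 x (hOS hx)).trans (by linarith)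
  · intro ω
    rw [← (e1 x hx).self_of_nhds]
    refine ((fderivWithin ℝ G S x).le_of_opNorm_le (hM1 x (hOS hx)) ω).trans ?_
    nlinarith [norm_nonneg ω]
  · intro ω
    rw [← (e1 x hx).fderiv_eq, ← fderivWithin_of_mem_nhds (mem_of_superset (hO.mem_nhds hx) hOS)]
    have h3 := (fderivWithin ℝ (fderivWithin ℝ G S) S x).le_of_opNorm_le (hM2 x (hOS hx)) ω
    refine ((fderivWithin ℝ (fderivWithin ℝ G S) S x ω).le_of_opNorm_le h3 ω).trans ?_
    nlinarith [sq_nonneg ‖ω‖]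

end Jet

end

/-! ### Symmetric Hessians, mixed derivatives, and the divergence term. -/

section

section Gradients

variable {V : Type*} [NormedAddCommGroup V] [InnerProductSpace ℝ V] [CompleteSpace V]

/-- The Riesz isomorphism as a real linear map. -/
def rieszMap : (V →L[ℝ] ℝ) →L[ℝ] V :=
  LinearMap.mkContinuous
    { toFun := (InnerProductSpace.toDual ℝ V).symm
      map_add' := map_add _
      map_smul' := fun r l => by simp } 1 fun l => by simp

theorem inner_rieszMap (l : V →L[ℝ] ℝ) (d : V) : inner ℝ (rieszMap l) d = l d :=
  InnerProductSpace.toDual_symm_apply (𝕜 := ℝ)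

theorem hasFDerivWithinAt_gradientWithin {S : Set V} {w : V → ℝ} (hu : UniqueDiffOn ℝ S)
    (hw : ContDiffOn ℝ 2 w S) {x : V} (hx : x ∈ S) (hx' : x ∈ closure (interior S)) :
    ∃ A : V →L[ℝ] V, HasFDerivWithinAt (fun y => gradientWithin w S y) A S x ∧
      ∀ a c, inner ℝ (A a) c = inner ℝ a (A c) := by
  have h1 : DifferentiableOn ℝ (fderivWithin ℝ w S) S :=
    (hw.fderivWithin hu (m := 1) (by norm_num)).differentiableOn (by simp)
  refine ⟨rieszMap.comp (fderivWithin ℝ (fderivWithin ℝ w S) S x),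
    rieszMap.hasFDerivAt.comp_hasFDerivWithinAt x (h1 x hx).hasFDerivWithinAt, fun a c => ?_⟩
  have hs : IsSymmSndFDerivWithinAt ℝ w S x :=
    (hw x hx).isSymmSndFDerivWithinAt (by simp) hu hx' hx
  rw [ContinuousLinearMap.comp_apply, inner_rieszMap, real_inner_comm, ContinuousLinearMap.comp_apply, inner_rieszMap]
  exact hs a c

theorem contDiffAt_gradient {w : V → ℝ} {x : V} (hw : ContDiffAt ℝ 3 w x) :
    ContDiffAt ℝ 2 (gradient w) x :=
  (InnerProductSpace.toDual ℝ V).symm.contDiff.contDiffAt.comp x (hw.fderiv_right (by norm_num))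

theorem fderiv_gradient_symm {w : V → ℝ} {x : V} (hw : ContDiffAt ℝ 2 w x) (a c : V) :
    inner ℝ (fderiv ℝ (gradient w) x a) c = inner ℝ a (fderiv ℝ (gradient w) x c) := by
  have h1 : DifferentiableAt ℝ (fderiv ℝ w) x :=
    (hw.fderiv_right (m := 1) (by norm_num)).differentiableAt (by simp)
  have h2 : HasFDerivAt (gradient w) (rieszMap.comp (fderiv ℝ (fderiv ℝ w) x)) x :=
    rieszMap.hasFDerivAt.comp x h1.hasFDerivAt
  have hs : IsSymmSndFDerivAt ℝ w x := hw.isSymmSndFDerivAt (by simp)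
  rw [h2.fderiv, ContinuousLinearMap.comp_apply, inner_rieszMap, real_inner_comm,
    ContinuousLinearMap.comp_apply, inner_rieszMap]
  exact hs a c

/-- Interchange of the time derivative and the spatial gradient. -/
theorem hasDerivAt_gradient_of_mixed {u g : V → ℝ → ℝ} {x₀ : V} {t₀ : ℝ}
    (hu : ∀ᶠ z : V × ℝ in 𝓝 (x₀, t₀), HasDerivAt (fun s => u z.1 s) (g z.1 z.2) z.2)
    (hux : ∀ᶠ t in 𝓝 t₀, DifferentiableAt ℝ (fun y => u y t) x₀)
    (hg : ∀ᶠ z : V × ℝ in 𝓝 (x₀, t₀), DifferentiableAt ℝ (fun y => g y z.2) z.1)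
    (hcont : ContinuousAt (fun z : V × ℝ => gradient (fun y => g y z.2) z.1) (x₀, t₀)) :
    HasDerivAt (fun t => gradient (fun y => u y t) x₀) (gradient (fun y => g y t₀) x₀) t₀ := by
  set G := gradient (fun y => g y t₀) x₀ with hG
  rw [hasDerivAt_iff_isLittleO, Asymptotics.isLittleO_iff]
  intro ε hε
  have hc : ∀ᶠ z : V × ℝ in 𝓝 (x₀, t₀), ‖gradient (fun y => g y z.2) z.1 - G‖ ≤ ε := by
    have : Tendsto (fun z : V × ℝ => ‖gradient (fun y => g y z.2) z.1 - G‖) (𝓝 (x₀, t₀))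
      (𝓝 ‖G - G‖) := (hcont.tendsto.sub_const G).norm
    rw [sub_self, norm_zero] at this
    exact (this.eventually (gt_mem_nhds hε)).mono fun z hz => hz.le
  obtain ⟨r, hr, hball⟩ := Metric.eventually_nhds_iff_ball.1 ((hu.and hg).and hc)
  have hin : ∀ y ∈ Metric.ball x₀ r, ∀ s ∈ Metric.ball t₀ r, (y, s) ∈ Metric.ball (x₀, t₀) r := by
    intro y hy s hs
    rw [← ball_prod_same]; exact ⟨hy, hs⟩
  have hux₀ := hux.self_of_nhds
  filter_upwards [hux, Metric.ball_mem_nhds t₀ hr] with t ht htr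
  -- The mean value inequality is applied twice, to g in space and then to u in time. It bounds the
  -- mixed second difference of u by ε |t − t₀| |y − x₀|, and hence the spatial derivative at x₀ of
  -- the difference quotient error.
  have key : ∀ y ∈ Metric.ball x₀ r, ‖(u y t - u y t₀ - (t - t₀) * inner ℝ G y) -
      (u x₀ t - u x₀ t₀ - (t - t₀) * inner ℝ G x₀)‖ ≤ ε * ‖t - t₀‖ * ‖y - x₀‖ := by
    intro y hy
    have space : ∀ s ∈ Metric.ball t₀ r,
        ‖(g y s - inner ℝ G y) - (g x₀ s - inner ℝ G x₀)‖ ≤ ε * ‖y - x₀‖ := by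
      intro s hs
      refine (convex_ball x₀ r).norm_image_sub_le_of_norm_hasFDerivWithin_le
        (f := fun y => g y s - inner ℝ G y)
        (f' := fun y => innerSL ℝ (gradient (fun y => g y s) y - G))
        (fun z hz => ?_) (fun z hz => ?_) (Metric.mem_ball_self hr) hy
      · have h1 := (hball _ (hin z hz s hs)).1.2.hasGradientAt.hasFDerivAt
        refine ((h1.sub (innerSL ℝ G).hasFDerivAt).congr_fderiv ?_).hasFDerivWithinAt
        ext d; simp
      · rw [innerSL_apply_norm]
        exact (hball _ (hin z hz s hs)).2
    have time := (convex_ball t₀ r).norm_image_sub_le_of_norm_hasDerivWithin_le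
      (f := fun s => u y s - u x₀ s - s * inner ℝ G (y - x₀))
      (f' := fun s => g y s - g x₀ s - 1 * inner ℝ G (y - x₀)) (C := ε * ‖y - x₀‖)
      (fun s hs => by
        have h1 := (hball _ (hin y hy s hs)).1.1
        have h2 := (hball _ (hin x₀ (Metric.mem_ball_self hr) s hs)).1.1
        exact ((h1.sub h2).sub ((hasDerivAt_id s).mul_const _)).hasDerivWithinAt)
      (fun s hs => by
        have := space s hs
        rw [inner_sub_right]
        refine le_of_eq_of_le ?_ this
        congr 1; ring)
      (Metric.mem_ball_self hr) htr
    convert time using 1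
    · rw [inner_sub_right]; congr 1; ring
    · ring
  have hd : HasFDerivAt (fun y => u y t - u y t₀ - (t - t₀) * inner ℝ G y)
      (innerSL ℝ (gradient (fun y => u y t) x₀ - gradient (fun y => u y t₀) x₀ - (t - t₀) • G))
      x₀ := by
    have h1 := (ht.hasGradientAt.hasFDerivAt.sub hux₀.hasGradientAt.hasFDerivAt).sub
      ((innerSL ℝ G).hasFDerivAt.const_mul (t - t₀))
    refine h1.congr_fderiv ?_
    ext d; simp
  have := hd.le_of_lip' (by positivity) (eventually_of_mem (Metric.ball_mem_nhds x₀ hr) key)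
  rwa [innerSL_apply_norm] at this

end Gradients

/-- Puts the equation in nondivergence form, tr A − (Ap · p)/v² with A = DH, which can be
differentiated once more. -/
theorem divergence_normalized {n : ℕ} {η : ℝ} (hη : 0 < η)
    {H : EuclideanSpace ℝ (Fin n) → EuclideanSpace ℝ (Fin n)} {x : EuclideanSpace ℝ (Fin n)}
    (hH : DifferentiableAt ℝ H x) :
    √(η ^ 2 + ‖H x‖ ^ 2) * divergence (fun y => (√(η ^ 2 + ‖H y‖ ^ 2))⁻¹ • H y) x =
      ∑ i, inner ℝ (fderiv ℝ H x (EuclideanSpace.basisFun (Fin n) ℝ i))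
          (EuclideanSpace.basisFun (Fin n) ℝ i) -
        inner ℝ (fderiv ℝ H x (H x)) (H x) / (η ^ 2 + ‖H x‖ ^ 2) := by
  have hv : 0 < √(η ^ 2 + ‖H x‖ ^ 2) := by positivity
  have hsq : √(η ^ 2 + ‖H x‖ ^ 2) ^ 2 = η ^ 2 + ‖H x‖ ^ 2 := Real.sq_sqrt (by positivity)
  have h1 : HasFDerivAt (fun y => (√(η ^ 2 + ‖H y‖ ^ 2))⁻¹)
      (fderiv ℝ (fun y => (√(η ^ 2 + ‖H y‖ ^ 2))⁻¹) x) x :=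
    (((differentiable_sqrt_add_norm_sq hη (H x)).comp x hH).inv hv.ne').hasFDerivAt
  have h2 : ∀ ω, fderiv ℝ (fun y => (√(η ^ 2 + ‖H y‖ ^ 2))⁻¹) x ω =
      -(inner ℝ (H x) (fderiv ℝ H x ω) / √(η ^ 2 + ‖H x‖ ^ 2)) / √(η ^ 2 + ‖H x‖ ^ 2) ^ 2 := by
    intro ω
    have l : HasFDerivAt H (fderiv ℝ H x) (x + (0 : ℝ) • ω) := by simpa using hH.hasFDerivAt
    have l2 : HasFDerivAt (fun y => (√(η ^ 2 + ‖H y‖ ^ 2))⁻¹)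
        (fderiv ℝ (fun y => (√(η ^ 2 + ‖H y‖ ^ 2))⁻¹) x) (x + (0 : ℝ) • ω) := by
      simpa using h1
    have l3 := l.comp_hasDerivAt (0 : ℝ) (hasDerivAt_line x ω 0)
    have l4 := l2.comp_hasDerivAt (0 : ℝ) (hasDerivAt_line x ω 0)
    have l5 := (hasDerivAt_sqrt_add_norm_sq hη l3).inv (by simpa using hv.ne')
    simpa using l4.unique l5
  have h3 := (h1.smul hH.hasFDerivAt).fderiv
  unfold divergence
  have h4 : ∀ i, (fderiv ℝ (fun y => (√(η ^ 2 + ‖H y‖ ^ 2))⁻¹ • H y) x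
      (EuclideanSpace.single i 1)) i = (√(η ^ 2 + ‖H x‖ ^ 2))⁻¹ *
        inner ℝ (fderiv ℝ H x (EuclideanSpace.basisFun (Fin n) ℝ i))
          (EuclideanSpace.basisFun (Fin n) ℝ i) -
        (√(η ^ 2 + ‖H x‖ ^ 2))⁻¹ / (η ^ 2 + ‖H x‖ ^ 2) *
          inner ℝ (H x) (fderiv ℝ H x ((H x i) • EuclideanSpace.basisFun (Fin n) ℝ i)) := by
    intro i
    have : fderiv ℝ (fun y => (√(η ^ 2 + ‖H y‖ ^ 2))⁻¹ • H y) x = _ := h3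
    rw [this]
    simp [h2, hsq, inner_smul_right, EuclideanSpace.inner_single_right]
    field_simp
    ring
  have h5 : ∑ i, inner ℝ (H x) (fderiv ℝ H x ((H x i) • EuclideanSpace.basisFun (Fin n) ℝ i)) =
      inner ℝ (fderiv ℝ H x (H x)) (H x) := by
    rw [← inner_sum, ← map_sum, real_inner_comm]
    congr 2
    have := (EuclideanSpace.basisFun (Fin n) ℝ).sum_repr (H x)
    simpa using this
  rw [Finset.sum_congr rfl fun i _ => h4 i, Finset.sum_sub_distrib, ← Finset.mul_sum,
    ← Finset.mul_sum, h5]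
  field_simp

end

/-! ### The auxiliary function at interior and boundary maxima. -/

section

variable {n : ℕ} {Ω : Set (EuclideanSpace ℝ (Fin n))}
  {u : EuclideanSpace ℝ (Fin n) → ℝ → ℝ} {T : ℝ}

theorem spaceGrad_eq_gradient (hΩ : IsOpen Ω) {x : EuclideanSpace ℝ (Fin n)} (hx : x ∈ Ω) (t : ℝ) :
    spaceGrad Ω u x t = gradient (fun y => u y t) x := by
  simp only [spaceGrad, gradientWithin, gradient]
  rw [fderivWithin_of_mem_nhds (mem_of_superset (hΩ.mem_nhds hx) subset_closure)]

theorem timeDeriv_hasDerivAt {σ : ℝ} (h2 : IsParabolicC2 σ Ω T u) {x : EuclideanSpace ℝ (Fin n)}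
    (hx : x ∈ Ω) {t : ℝ} (ht : t ∈ Ioo 0 T) :
    HasDerivAt (fun s => u x s) (timeDeriv T u x t) t := by
  have hmem : Icc 0 T ∈ 𝓝 t := Icc_mem_nhds ht.1 ht.2
  have h := (h2.time x (subset_closure hx) t (Ioo_subset_Icc_self ht)).differentiableAt hmem
  rw [timeDeriv, derivWithin_of_mem_nhds hmem]
  exact h.hasDerivAt

theorem hasDerivAt_spaceGrad {σ : ℝ} (hΩ : IsOpen Ω) (h2 : IsParabolicC2 σ Ω T u)
    (h3 : IsParabolicC3Interior σ Ω T u) {x : EuclideanSpace ℝ (Fin n)} (hx : x ∈ Ω) {t : ℝ}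
    (ht : t ∈ Ioo 0 T) :
    HasDerivAt (fun s => spaceGrad Ω u x s) (gradient (fun y => timeDeriv T u y t) x) t := by
  have hnhds : Ω ×ˢ Ioo 0 T ∈ 𝓝 (x, t) := (hΩ.prod isOpen_Ioo).mem_nhds ⟨hx, ht⟩
  have hmain := hasDerivAt_gradient_of_mixed (u := u) (g := timeDeriv T u) (x₀ := x) (t₀ := t)
    (by
      filter_upwards [hnhds] with z hz
      exact timeDeriv_hasDerivAt h2 hz.1 hz.2)
    (by
      filter_upwards [isOpen_Ioo.mem_nhds ht] with s hs
      exact ((h3.space s ⟨hs.1, hs.2.le⟩).contDiffAt (hΩ.mem_nhds hx)).differentiableAt (by simp))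
    (by
      filter_upwards [hnhds] with z hz
      exact (h3.timeDeriv_space z.2 ⟨hz.2.1, hz.2.2.le⟩).differentiableAt (hΩ.mem_nhds hz.1))
    (h3.continuousOn_grad_timeDeriv.continuousAt
      (mem_of_superset hnhds (prod_mono le_rfl Ioo_subset_Ioc_self)))
  simpa only [spaceGrad_eq_gradient hΩ hx] using hmain

/-- Separates the x-derivative, which is bounded, from the z-derivative times the gradient, where
only a sign is known. -/
theorem hasFDerivAt_comp_graph {c : EuclideanSpace ℝ (Fin n) → ℝ → ℝ} (hΩ : IsOpen Ω)
    (hc : ContDiffOn ℝ 1 (fun p : EuclideanSpace ℝ (Fin n) × ℝ => c p.1 p.2)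
      (closure Ω ×ˢ (univ : Set ℝ))) {x : EuclideanSpace ℝ (Fin n)} (hx : x ∈ Ω)
    {w : EuclideanSpace ℝ (Fin n) → ℝ} (hw : DifferentiableAt ℝ w x) :
    HasFDerivAt (fun y => c y (w y)) (innerSL ℝ
      (gradientWithin (fun y => c y (w x)) (closure Ω) x +
        deriv (fun s => c x s) (w x) • gradient w x)) x := by
  have hmem : closure Ω ∈ 𝓝 x := mem_of_superset (hΩ.mem_nhds hx) subset_closure
  have h1 : HasFDerivAt (fun p : EuclideanSpace ℝ (Fin n) × ℝ => c p.1 p.2)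
      (fderiv ℝ (fun p : EuclideanSpace ℝ (Fin n) × ℝ => c p.1 p.2) (x, w x)) (x, w x) :=
    ((hc.contDiffAt (prod_mem_nhds hmem univ_mem)).differentiableAt (by simp)).hasFDerivAt
  have h2 := h1.comp x ((hasFDerivAt_id x).prodMk hw.hasGradientAt.hasFDerivAt)
  have h3 := (h1.comp (f := fun y => (y, w x)) x ((hasFDerivAt_id x).prodMk (hasFDerivAt_const (w x) x)))
  have h4 := h1.comp_hasDerivAt (w x)
    ((hasDerivAt_const (w x) x).prodMk (hasDerivAt_id (w x)))
  have h3' : HasFDerivAt (fun y => c y (w x)) _ x := h3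
  have h4' : HasDerivAt (fun s => c x s) _ (w x) := h4
  refine h2.congr_fderiv ?_
  ext d
  have e1 : inner ℝ (gradientWithin (fun y => c y (w x)) (closure Ω) x) d =
      fderiv ℝ (fun y => c y (w x)) x d := by
    rw [gradientWithin, fderivWithin_of_mem_nhds hmem]
    exact InnerProductSpace.toDual_symm_apply (𝕜 := ℝ)
  simp only [innerSL_apply_apply, inner_add_left, inner_smul_left, conj_trivial]
  rw [e1, h3'.fderiv, h4'.deriv]
  simp only [ContinuousLinearMap.comp_apply, ContinuousLinearMap.prod_apply,
    InnerProductSpace.toDual_apply_apply, ContinuousLinearMap.id_apply, zero_apply]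
  set L := fderiv ℝ (fun p : EuclideanSpace ℝ (Fin n) × ℝ => c p.1 p.2) (x, w x)
  have : (d, inner ℝ (gradient w x) d) =
      (d, (0 : ℝ)) + inner ℝ (gradient w x) d • ((0 : EuclideanSpace ℝ (Fin n)), (1 : ℝ)) := by
    simp
  rw [this, map_add, map_smul, smul_eq_mul, mul_comm]

/-- The function to which the maximum principle is applied. -/
def auxiliary (η q K M : ℝ) (Ω : Set (EuclideanSpace ℝ (Fin n)))
    (b : EuclideanSpace ℝ (Fin n) → EuclideanSpace ℝ (Fin n)) (h : EuclideanSpace ℝ (Fin n) → ℝ)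
    (u : EuclideanSpace ℝ (Fin n) → ℝ → ℝ) (z : EuclideanSpace ℝ (Fin n) × ℝ) : ℝ :=
  Real.log (η ^ 2 + ‖corrected η q (spaceGrad Ω u z.1 z.2) (b z.1)‖ ^ 2) / 2 + K * h z.1 - M * z.2

section Max

variable {η q K M B N C σ t : ℝ} {b : EuclideanSpace ℝ (Fin n) → EuclideanSpace ℝ (Fin n)}
  {h : EuclideanSpace ℝ (Fin n) → ℝ} {x : EuclideanSpace ℝ (Fin n)}
  {c f : EuclideanSpace ℝ (Fin n) → ℝ → ℝ} {φ u₀ : EuclideanSpace ℝ (Fin n) → ℝ}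

theorem isLocalMaxOn_space
    (hmax : IsMaxFilter (auxiliary η q K M Ω b h u) (𝓝[closure Ω ×ˢ Icc 0 t] (x, t)) (x, t))
    (ht : 0 < t) :
    IsLocalMaxOn (fun y => Real.log (η ^ 2 + ‖corrected η q (spaceGrad Ω u y t) (b y)‖ ^ 2) / 2 +
      K * h y) (closure Ω) x := by
  have h1 : Tendsto (fun y : EuclideanSpace ℝ (Fin n) => (y, t)) (𝓝[closure Ω] x)
      (𝓝[closure Ω ×ˢ Icc 0 t] (x, t)) := by
    refine tendsto_nhdsWithin_iff.2 ⟨?_, ?_⟩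
    · exact ((Continuous.prodMk_left t).tendsto x).mono_left nhdsWithin_le_nhds
    · filter_upwards [self_mem_nhdsWithin] with y hy using ⟨hy, ht.le, le_rfl⟩
  have h2 : ∀ᶠ z in 𝓝[closure Ω ×ˢ Icc 0 t] (x, t), auxiliary η q K M Ω b h u z ≤
    auxiliary η q K M Ω b h u (x, t) := hmax
  filter_upwards [h1.eventually h2] with y hy
  simp only [auxiliary] at hy
  linarith

/-- A maximum over the past cylinder has nonnegative backward time derivative. Since b and h do not
depend on t, only Du_t paired with `direction` is left to balance −M. -/
theorem time_growth_le (hΩ : IsOpen Ω) (hη : 0 < η) (h2 : IsParabolicC2 σ Ω T u)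
    (h3 : IsParabolicC3Interior σ Ω T u) (hx : x ∈ Ω) (ht : t ∈ Ioo 0 T)
    (hmax : IsMaxFilter (auxiliary η q K M Ω b h u) (𝓝[closure Ω ×ˢ Icc 0 t] (x, t)) (x, t)) :
    M ≤ inner ℝ (direction η q (spaceGrad Ω u x t) (b x))
      (gradient (fun y => timeDeriv T u y t) x) := by
  have h1 : Tendsto (fun s : ℝ => (x, s)) (𝓝[Icc 0 t] t) (𝓝[closure Ω ×ˢ Icc 0 t] (x, t)) := by
    refine tendsto_nhdsWithin_iff.2 ⟨?_, ?_⟩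
    · exact ((Continuous.prodMk_right x).tendsto t).mono_left nhdsWithin_le_nhds
    · filter_upwards [self_mem_nhdsWithin] with s hs using ⟨subset_closure hx, hs⟩
  have hloc : IsLocalMaxOn (fun s => auxiliary η q K M Ω b h u (x, s)) (Icc 0 t) t :=
    h1.eventually hmax
  have hd := (((hasDerivAt_half_log hη (hasDerivAt_corrected (q := q) hη
    (hasDerivAt_spaceGrad hΩ h2 h3 hx ht) (hasDerivAt_const t (b x)))).add_const (K * h x)).sub
    ((hasDerivAt_id t).const_mul M))
  have hd' : HasDerivAt (fun s => auxiliary η q K M Ω b h u (x, s)) _ t := hd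
  have hcone : (-1 : ℝ) ∈ posTangentConeAt (Icc 0 t) t := by
    refine mem_posTangentConeAt_of_frequently_mem (Eventually.frequently ?_)
    filter_upwards [Ioo_mem_nhdsGT ht.1] with r hr
    constructor <;> simp <;> linarith [hr.1, hr.2]
  have := hloc.hasFDerivWithinAt_nonpos hd'.hasFDerivAt.hasFDerivWithinAt hcone
  rw [inner_corrected_correctedDeriv] at this
  simp at this ⊢
  linarith

theorem interior_max_bound (hΩ : IsOpen Ω) (h2 : IsParabolicC2 σ Ω T u)
    (h3 : IsParabolicC3Interior σ Ω T u) (hsol : IsSolution η q Ω T c f φ u₀ u)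
    (hc : ContDiffOn ℝ 1 (fun p : EuclideanSpace ℝ (Fin n) × ℝ => c p.1 p.2)
      (closure Ω ×ˢ (univ : Set ℝ)))
    (hf : ContDiffOn ℝ 1 (fun p : EuclideanSpace ℝ (Fin n) × ℝ => f p.1 p.2)
      (closure Ω ×ˢ (univ : Set ℝ)))
    (hcb : ∀ x ∈ closure Ω, ∀ z : ℝ,
      |c x z| ≤ C ∧ ‖gradientWithin (fun y => c y z) (closure Ω) x‖ ≤ C ∧
        deriv (fun s => c x s) z ≤ 0)
    (hfb : ∀ x ∈ closure Ω, ∀ z : ℝ,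
      |f x z| ≤ C ∧ ‖gradientWithin (fun y => f y z) (closure Ω) x‖ ≤ C ∧
        0 ≤ deriv (fun s => f x s) z)
    (hK : 0 ≤ K) (hx : x ∈ Ω) (ht : t ∈ Ioo 0 T) (hL : Large η q B (spaceGrad Ω u x t))
    (hb : JetBound B b x) (hh : JetBound N h x)
    (hmax : IsMaxFilter (auxiliary η q K M Ω b h u) (𝓝[closure Ω ×ˢ Icc 0 t] (x, t)) (x, t)) :
    M ≤ interiorConst n N K C := by
  have hM := time_growth_le hΩ hL.pos h2 h3 hx ht hmax
  have hmem : closure Ω ∈ 𝓝 x := mem_of_superset (hΩ.mem_nhds hx) subset_closure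
  have hspace : IsLocalMax (fun y =>
      Real.log (η ^ 2 + ‖corrected η q (spaceGrad Ω u y t) (b y)‖ ^ 2) / 2 + K * h y) x :=
    (isLocalMaxOn_space hmax ht.1).isLocalMax hmem
  have hu3 : ∀ y ∈ Ω, ContDiffAt ℝ 3 (fun y => u y t) y := fun y hy =>
    (h3.space t ⟨ht.1, ht.2.le⟩).contDiffAt (hΩ.mem_nhds hy)
  have heq : ∀ y ∈ Ω, (fun y => spaceGrad Ω u y t) =ᶠ[𝓝 y] gradient (fun y => u y t) :=
    fun y hy => by
      filter_upwards [hΩ.mem_nhds hy] with z hz using spaceGrad_eq_gradient hΩ hz t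
  have hH : ∀ y ∈ Ω, ContDiffAt ℝ 2 (fun y => spaceGrad Ω u y t) y := fun y hy =>
    (contDiffAt_gradient (hu3 y hy)).congr_of_eventuallyEq (heq y hy)
  have hsym : ∀ᶠ y in 𝓝 x, ∀ a d, inner ℝ (fderiv ℝ (fun y => spaceGrad Ω u y t) y a) d =
      inner ℝ a (fderiv ℝ (fun y => spaceGrad Ω u y t) y d) := by
    filter_upwards [hΩ.mem_nhds hx] with y hy a d
    rw [(heq y hy).fderiv_eq]
    exact fderiv_gradient_symm ((hu3 y hy).of_le (by norm_num)) a d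
  have hg : HasFDerivAt (fun y => timeDeriv T u y t)
      (InnerProductSpace.toDual ℝ _ (gradient (fun y => timeDeriv T u y t) x)) x :=
    ((h3.timeDeriv_space t ⟨ht.1, ht.2.le⟩).differentiableAt
      (hΩ.mem_nhds hx)).hasGradientAt.hasFDerivAt
  have hgeq : (fun y => timeDeriv T u y t) =ᶠ[𝓝 x] fun y =>
      ∑ i, inner ℝ (fderiv ℝ (fun y => spaceGrad Ω u y t) y
          (EuclideanSpace.basisFun (Fin n) ℝ i)) (EuclideanSpace.basisFun (Fin n) ℝ i) -
        inner ℝ (fderiv ℝ (fun y => spaceGrad Ω u y t) y (spaceGrad Ω u y t))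
          (spaceGrad Ω u y t) / (η ^ 2 + ‖spaceGrad Ω u y t‖ ^ 2) +
        c y (u y t) * √(η ^ 2 + ‖spaceGrad Ω u y t‖ ^ 2) - f y (u y t) := by
    filter_upwards [hΩ.mem_nhds hx] with y hy
    rw [← divergence_normalized hL.pos ((hH y hy).differentiableAt (by simp))]
    exact hsol.equation y hy t ht
  have hud : DifferentiableAt ℝ (fun y => u y t) x := (hu3 x hx).differentiableAt (by simp)
  have hcd := hasFDerivAt_comp_graph hΩ hc hx hud
  have hfd := hasFDerivAt_comp_graph hΩ hf hx hud
  rw [← spaceGrad_eq_gradient hΩ hx t] at hcd hfd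
  obtain ⟨c1, c2, c3⟩ := hcb x (subset_closure hx) (u x t)
  obtain ⟨-, f2, f3⟩ := hfb x (subset_closure hx) (u x t)
  have := deriv_source_le hK hL (hH x hx) hb hh hspace hsym (EuclideanSpace.basisFun (Fin n) ℝ)
    hg hgeq hcd hfd c1 c2 f2 c3 f3
  rw [Fintype.card_fin, InnerProductSpace.toDual_apply_apply, real_inner_comm] at this
  exact hM.trans this

theorem boundary_max_bound (hΩ : IsBoundedDomainOfClass 3 Ω) (h2 : IsParabolicC2 σ Ω T u)
    (hsol : IsSolution η q Ω T c f φ u₀ u) {δ : ℝ}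
    {Y : EuclideanSpace ℝ (Fin n) → EuclideanSpace ℝ (Fin n)}
    (hY : ∀ y ∈ frontier Ω, ∀ ν, IsOutwardUnitNormal Ω y ν → Y y = ν)
    (hYd : DifferentiableOn ℝ Y (closure Ω))
    (hYb : ∀ ω, ‖fderivWithin ℝ Y (closure Ω) x ω‖ ≤ B * ‖ω‖)
    (hb : ∀ y, b y = φ y • Y y) (hbd : DifferentiableOn ℝ b (closure Ω))
    (hb0 : ‖b x‖ ≤ B) (hbb : ∀ ω, ‖fderivWithin ℝ b (closure Ω) x ω‖ ≤ B * ‖ω‖)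
    (hh : DifferentiableAt ℝ h x)
    (hhν : ∀ ν, IsOutwardUnitNormal Ω x ν → ∃ m : ℝ, δ ≤ m ∧ fderiv ℝ h x = -(m • innerSL ℝ ν))
    (hK : 0 ≤ K) (hx : x ∈ frontier Ω) (ht : t ∈ Ioo 0 T)
    (hL : Large η q B (spaceGrad Ω u x t))
    (hmax : IsMaxFilter (auxiliary η q K M Ω b h u) (𝓝[closure Ω ×ˢ Icc 0 t] (x, t)) (x, t)) :
    K * δ ≤ 3 + 18 * B := by
  have hη := hL.pos
  have hxS : x ∈ closure Ω := frontier_subset_closure hx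
  have hu := hΩ.uniqueDiffOn (by norm_num)
  have hspace := isLocalMaxOn_space hmax ht.1
  obtain ⟨ν, hν⟩ := hΩ.exists_normal (by norm_num) hx
  obtain ⟨m, hm, hhm⟩ := hhν ν hν
  obtain ⟨A, hA, hAs⟩ := hasFDerivWithinAt_gradientWithin hu
    (h2.space t (Ioo_subset_Icc_self ht)) hxS
    (closure_mono (interior_maximal subset_closure hΩ.isOpen) hxS)
  have hA' : HasFDerivWithinAt (fun y => spaceGrad Ω u y t) A (closure Ω) x := hA
  have hbw := (hbd x hxS).hasFDerivWithinAt
  have hYw := (hYd x hxS).hasFDerivWithinAt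
  have horth : ∀ y ∈ frontier Ω,
      inner ℝ (corrected η q (spaceGrad Ω u y t) (b y)) (Y y) = 0 := by
    intro y hy
    obtain ⟨μ, hμ⟩ := hΩ.exists_normal (by norm_num) hy
    have h1 : inner ℝ (spaceGrad Ω u y t) μ =
        φ y * √(η ^ 2 + ‖spaceGrad Ω u y t‖ ^ 2) ^ (1 - q) :=
      hsol.boundary y hy μ hμ t ⟨ht.1.le, ht.2⟩
    rw [hb, hY y hy μ hμ, corrected, inner_sub_left, inner_smul_left, inner_smul_left,
      real_inner_self_eq_norm_sq, hμ.norm_eq_one, h1]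
    simp only [conj_trivial]
    ring
  have hYx := hY x hx ν hν
  refine multiplier_le (φ := φ x) (ν := ν) hL hK hAs hν.norm_eq_one (by rw [← hYx]; exact hb x)
    hb0 hbb hYb (by rw [← hYx]; exact horth x hx) (h' := fderiv ℝ h x) ?_ ?_ ?_ ?_
  · rw [hhm]
    simp [hν.norm_eq_one, hm]
  · intro τ hτ
    rw [hhm]
    rw [real_inner_comm] at hτ
    simp [hτ]
  · intro ω hω
    have hW := ((differentiable_half_log_corrected hη q
      (spaceGrad Ω u x t, b x)).hasFDerivAt.comp_hasFDerivWithinAt x (hA'.prodMk hbw)).add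
      (hh.hasFDerivAt.hasFDerivWithinAt.const_mul K)
    have := hspace.hasFDerivWithinAt_nonpos hW (hν.mem_posTangentConeAt hΩ.isOpen hω)
    simpa [fderiv_half_log_corrected hη] using this
  · intro τ hτ
    have hP := ((differentiable_corrected hη q
      (spaceGrad Ω u x t, b x)).hasFDerivAt.comp_hasFDerivWithinAt x (hA'.prodMk hbw))
    have h1 := (hP.inner ℝ hYw).mono (frontier_subset_closure (s := Ω))
    have h0 : HasFDerivWithinAt (fun y => inner ℝ (((fun z : EuclideanSpace ℝ (Fin n) ×
        EuclideanSpace ℝ (Fin n) => corrected η q z.1 z.2) ∘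
          fun y => (spaceGrad Ω u y t, b y)) y) (Y y))
        (0 : EuclideanSpace ℝ (Fin n) →L[ℝ] ℝ) (frontier Ω) x :=
      (hasFDerivWithinAt_const (0 : ℝ) x (frontier Ω)).congr (fun y hy => horth y hy) (horth x hx)
    -- The identity P · Y = 0 holds only on the frontier, so its derivative is known to vanish only
    -- along the tangent cone of the frontier, which contains τ.
    have := h1.unique_on h0 (hν.mem_tangentConeAt_frontier hΩ.isOpen hτ)
    simp [fderivInnerCLM_apply, fderiv_corrected hη, hYx] at this
    linarith

end Max

end

/-! ### Choice of constants and the gradient bound. -/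

section

variable {n : ℕ} {Ω : Set (EuclideanSpace ℝ (Fin n))}

/-- Here q > 0 enters, through v^{-q} → 0. The threshold depends only on q and B, hence not on η. -/
theorem exists_large (q B : ℝ) (hq : 0 < q) :
    ∃ v₀ : ℝ, 2 ≤ v₀ ∧ ∀ v : ℝ, v₀ ≤ v → 100 * (1 + q) ^ 2 * (v ^ (-q) * B) ≤ 1 := by
  have h1 : Tendsto (fun v : ℝ => 100 * (1 + q) ^ 2 * (v ^ (-q) * B)) atTop
      (𝓝 (100 * (1 + q) ^ 2 * (0 * B))) :=
    ((tendsto_rpow_neg_atTop hq).mul_const B).const_mul _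
  rw [zero_mul, mul_zero] at h1
  obtain ⟨v₁, hv₁⟩ := eventually_atTop.1 (h1.eventually (gt_mem_nhds one_pos))
  exact ⟨max 2 v₁, le_max_left _ _, fun v hv => (hv₁ v ((le_max_right _ _).trans hv)).le⟩

theorem continuousOn_auxiliary {u : EuclideanSpace ℝ (Fin n) → ℝ → ℝ} {T σ η q K M : ℝ}
    {b : EuclideanSpace ℝ (Fin n) → EuclideanSpace ℝ (Fin n)} {h : EuclideanSpace ℝ (Fin n) → ℝ}
    (hη : 0 < η) (h2 : IsParabolicC2 σ Ω T u) (hb : ContinuousOn b (closure Ω))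
    (hh : Continuous h) :
    ContinuousOn (auxiliary η q K M Ω b h u) (closure Ω ×ˢ Icc 0 T) := by
  have h1 : ContinuousOn (fun z : EuclideanSpace ℝ (Fin n) × ℝ => (spaceGrad Ω u z.1 z.2, b z.1))
      (closure Ω ×ˢ Icc 0 T) :=
    h2.continuousOn_grad.prodMk (hb.comp continuousOn_fst fun z hz => hz.1)
  exact (((differentiable_half_log_corrected hη q).continuous.comp_continuousOn h1).add
    (continuous_const.mul (hh.comp continuous_fst)).continuousOn).sub
    (continuous_const.mul continuous_snd).continuousOn

/-- The gradient bound, once all maxima of the auxiliary function with large gradient and positive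
time are excluded. -/
theorem norm_spaceGrad_le_of_no_max {u : EuclideanSpace ℝ (Fin n) → ℝ → ℝ}
    {T σ η q K M B N v₀ G t : ℝ}
    {b : EuclideanSpace ℝ (Fin n) → EuclideanSpace ℝ (Fin n)} {h : EuclideanSpace ℝ (Fin n) → ℝ}
    {x : EuclideanSpace ℝ (Fin n)}
    (hcpt : IsCompact (closure Ω)) (hη : 0 < η) (hη1 : η ≤ 1) (hK : 0 ≤ K) (hM : 0 ≤ M)
    (h2 : IsParabolicC2 σ Ω T u) (hbc : ContinuousOn b (closure Ω)) (hhc : Continuous h)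
    (hb : ∀ y ∈ closure Ω, ‖b y‖ ≤ B) (hh : ∀ y ∈ closure Ω, |h y| ≤ N) (hv₀ : 2 ≤ v₀)
    (hG : 0 ≤ G)
    (hlarge : ∀ p : EuclideanSpace ℝ (Fin n), v₀ ≤ √(η ^ 2 + ‖p‖ ^ 2) → Large η q B p)
    (hinit : ∀ y ∈ closure Ω, ‖spaceGrad Ω u y 0‖ ≤ G)
    (hno : ∀ y ∈ closure Ω, ∀ s ∈ Ioo 0 T, v₀ ≤ √(η ^ 2 + ‖spaceGrad Ω u y s‖ ^ 2) →
      ¬ IsMaxFilter (auxiliary η q K M Ω b h u) (𝓝[closure Ω ×ˢ Icc 0 s] (y, s)) (y, s))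
    (hx : x ∈ closure Ω) (ht : t ∈ Ico 0 T) :
    ‖spaceGrad Ω u x t‖ ≤ 2 * (v₀ + 1 + G) * Real.exp (2 * K * N + M * T) := by
  have hN : 0 ≤ N := (abs_nonneg _).trans (hh x hx)
  have hT : 0 < T := ht.1.trans_lt ht.2
  have hexp : 1 ≤ Real.exp (2 * K * N + M * T) := Real.one_le_exp (by positivity)
  rcases lt_or_ge (√(η ^ 2 + ‖spaceGrad Ω u x t‖ ^ 2)) v₀ with hlt | hge
  · have h1 : ‖spaceGrad Ω u x t‖ ≤ √(η ^ 2 + ‖spaceGrad Ω u x t‖ ^ 2) :=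
      Real.le_sqrt_of_sq_le (by nlinarith)
    nlinarith
  have hsub : closure Ω ×ˢ Icc 0 t ⊆ closure Ω ×ˢ Icc 0 T :=
    prod_mono le_rfl (Icc_subset_Icc_right ht.2.le)
  have hvc : ContinuousOn (fun z : EuclideanSpace ℝ (Fin n) × ℝ =>
      √(η ^ 2 + ‖spaceGrad Ω u z.1 z.2‖ ^ 2)) (closure Ω ×ˢ Icc 0 T) :=
    (continuousOn_const.add (h2.continuousOn_grad.norm.pow 2)).sqrt
  have hQ : IsCompact (closure Ω ×ˢ Icc 0 t) := hcpt.prod isCompact_Icc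
  -- The maximum is taken only where v ≥ v₀, since the estimates need a large gradient, and only up
  -- to a time t < T, where the equation and the boundary condition are available.
  have hSc : IsCompact ((closure Ω ×ˢ Icc 0 t) ∩ (fun z : EuclideanSpace ℝ (Fin n) × ℝ =>
      √(η ^ 2 + ‖spaceGrad Ω u z.1 z.2‖ ^ 2)) ⁻¹' Ici v₀) :=
    hQ.of_isClosed_subset ((hvc.mono hsub).preimage_isClosed_of_isClosed hQ.isClosed isClosed_Ici)
      inter_subset_left
  obtain ⟨⟨x₁, t₁⟩, ⟨⟨hx₁, ht₁⟩, hv₁⟩, hmax⟩ := hSc.exists_isMaxOn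
    ⟨(x, t), ⟨hx, ht.1, le_rfl⟩, hge⟩
    ((continuousOn_auxiliary (q := q) (K := K) (M := M) hη h2 hbc hhc).mono
      (inter_subset_left.trans hsub))
  have hle : auxiliary η q K M Ω b h u (x, t) ≤ auxiliary η q K M Ω b h u (x₁, t₁) :=
    hmax ⟨⟨hx, ht.1, le_rfl⟩, hge⟩
  simp only [mem_preimage, mem_Ici] at hv₁ hx₁ ht₁
  -- There are three cases. If v = v₀ the bound is immediate; at time 0 it follows from √(1 + G²) ≤
  -- 1 + G. Otherwise v > v₀ nearby by continuity, so the constrained maximum is a genuine local one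
  -- on the past cylinder, which is excluded.
  have hv₁' : √(η ^ 2 + ‖spaceGrad Ω u x₁ t₁‖ ^ 2) ≤ v₀ + 1 + G := by
    rcases hv₁.eq_or_lt with heq | hlt
    · rw [← heq]; linarith
    rcases ht₁.1.eq_or_lt with h0 | hpos
    · rw [← h0]
      have := hinit x₁ hx₁
      refine (Real.sqrt_le_left (by linarith)).2 ?_
      nlinarith [norm_nonneg (spaceGrad Ω u x₁ 0)]
    · exfalso
      refine hno x₁ hx₁ t₁ ⟨hpos, ht₁.2.trans_lt ht.2⟩ hv₁ ?_
      have hsub' : closure Ω ×ˢ Icc 0 t₁ ⊆ closure Ω ×ˢ Icc 0 t :=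
        prod_mono le_rfl (Icc_subset_Icc_right ht₁.2)
      have hcw := ((hvc.mono hsub).mono hsub') (x₁, t₁) ⟨hx₁, hpos.le, le_rfl⟩
      have hev := hcw.eventually (lt_mem_nhds hlt)
      filter_upwards [hev, self_mem_nhdsWithin] with z hz1 hz2
      exact hmax ⟨hsub' hz2, hz1.le⟩
  have hE := ((hlarge _ hge).energy_bounds (hb x hx)).1
  have hE₁ := ((hlarge _ hv₁).energy_bounds (hb x₁ hx₁)).2
  have hnorm := (hlarge _ hge).norm_le
  have ha := abs_le.1 (hh x hx)
  have ha₁ := abs_le.1 (hh x₁ hx₁)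
  simp only [auxiliary] at hle
  have hEpos₁ : 0 < η ^ 2 + ‖corrected η q (spaceGrad Ω u x₁ t₁) (b x₁)‖ ^ 2 := by positivity
  have hl1 := Real.log_le_log (by positivity) hE
  have hl2 := Real.log_le_log hEpos₁ (hE₁.trans (b := _)
    (c := 2 * (v₀ + 1 + G) ^ 2) (by gcongr))
  generalize √(η ^ 2 + ‖spaceGrad Ω u x t‖ ^ 2) = v at *
  have k1 : K * h x₁ ≤ K * N := by gcongr; exact ha₁.2
  have k2 : -(K * N) ≤ K * h x := by
    have := mul_le_mul_of_nonneg_left ha.1 hK; linarith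
  have k3 : M * t ≤ M * T := by gcongr; exact ht.2.le
  have k4 : 0 ≤ M * t₁ := mul_nonneg hM ht₁.1
  have hlog : Real.log (v ^ 2 / 2) ≤
      Real.log (2 * (v₀ + 1 + G) ^ 2) + 2 * (2 * K * N + M * T) := by linarith
  have hv0 : 0 < v := by linarith
  have hV : 0 < v₀ + 1 + G := by linarith
  rw [← Real.log_exp (2 * (2 * K * N + M * T)), ← Real.log_mul (by positivity) (by positivity)]
    at hlog
  have hsq := (Real.log_le_log_iff (by positivity) (by positivity)).1 hlog
  rw [two_mul (2 * K * N + M * T), Real.exp_add] at hsq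
  refine hnorm.trans (abs_le_of_sq_le_sq' ?_ (by positivity)).2
  nlinarith

/-- The gradient bound on `[0, T)`. -/
theorem exists_gradient_bound (hΩ : IsBoundedDomainOfClass 3 Ω)
    {c f : EuclideanSpace ℝ (Fin n) → ℝ → ℝ} {α : ℝ}
    (hc : ForcingAssumption α Ω c) (hf : TransportAssumption α Ω f)
    {φ : EuclideanSpace ℝ (Fin n) → ℝ} (hφ : ContDiffOn ℝ 3 φ (closure Ω))
    {q : ℝ} (hq : 0 < q) {u₀ : EuclideanSpace ℝ (Fin n) → ℝ}
    (hu₀ : ContDiffOn ℝ 2 u₀ (closure Ω)) {T : ℝ} :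
    ∃ R : ℝ, ∀ η ∈ Ioc (0 : ℝ) 1, ∀ σ : ℝ, ∀ u : EuclideanSpace ℝ (Fin n) → ℝ → ℝ,
      IsParabolicC2 σ Ω T u → IsParabolicC3Interior σ Ω T u → IsSolution η q Ω T c f φ u₀ u →
        ∀ x ∈ closure Ω, ∀ t ∈ Ico (0 : ℝ) T, ‖spaceGrad Ω u x t‖ ≤ R := by
  have hcpt : IsCompact (closure Ω) := hΩ.isBounded.isCompact_closure
  have hu := hΩ.uniqueDiffOn (by norm_num)
  obtain ⟨ρ, hρ, δ, hδ, hρd⟩ := hΩ.exists_weight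
  obtain ⟨Y, hY, hYν⟩ := exists_normal_extension hρ hδ hρd
    fun y hy => hΩ.exists_normal (by norm_num) hy
  have hb : ContDiffOn ℝ 2 (fun y => φ y • Y y) (closure Ω) :=
    (hφ.of_le (by norm_num)).smul hY.contDiffOn
  have hh : ContDiff ℝ 2 (fun y => -ρ y) := (hρ.of_le (by norm_num)).neg
  obtain ⟨B₁, hB₁, hB₁'⟩ := exists_jetBound hcpt hu hΩ.isOpen subset_closure hb
  obtain ⟨B₂, hB₂, -⟩ := exists_jetBound hcpt hu hΩ.isOpen subset_closure hY.contDiffOn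
  obtain ⟨N, hN, hN'⟩ := exists_jetBound hcpt hu hΩ.isOpen subset_closure hh.contDiffOn
  obtain ⟨G, hG, -⟩ := exists_jetBound hcpt hu hΩ.isOpen subset_closure hu₀
  obtain ⟨⟨hc1, -⟩, C₁, hC₁⟩ := hc
  obtain ⟨⟨hf1, -⟩, C₂, hC₂⟩ := hf
  set B := max B₁ B₂ with hBdef
  set C := max C₁ C₂
  obtain ⟨x₀, hx₀⟩ := hΩ.isConnected.nonempty
  have hx₀' := subset_closure hx₀
  have hB0 : 0 ≤ B := (norm_nonneg _).trans ((hB₁ x₀ hx₀').1.trans (le_max_left _ _))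
  have hN0 : 0 ≤ N := (norm_nonneg _).trans (hN x₀ hx₀').1
  have hC0 : 0 ≤ C := (abs_nonneg _).trans ((hC₁ x₀ hx₀' 0).1.trans (le_max_left _ _))
  have hG0 : 0 ≤ G := (norm_nonneg _).trans (hG x₀ hx₀').1
  obtain ⟨v₀, hv₀, hlarge⟩ := exists_large q B hq
  -- K exceeds the boundary threshold by making Kδ = 4 + 18B. M is then chosen after K, one above
  -- the interior threshold.
  set K := (3 + 18 * B + 1) / δ with hKdef
  have hK : 0 ≤ K := by positivity
  set M := interiorConst n N K C + 1 with hMdef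
  have hM : 0 ≤ M := by
    have : 0 ≤ interiorConst n N K C := by unfold interiorConst; positivity
    positivity
  refine ⟨2 * (v₀ + 1 + G) * Real.exp (2 * K * N + M * T),
    fun η hη σ u h2 h3 hsol x hx t ht => ?_⟩
  have hL : ∀ p : EuclideanSpace ℝ (Fin n), v₀ ≤ √(η ^ 2 + ‖p‖ ^ 2) → Large η q B p :=
    fun p hp => ⟨hη.1, hη.2, hq, hB0, hv₀.trans hp, hlarge _ hp⟩
  refine norm_spaceGrad_le_of_no_max (q := q) (b := fun y => φ y • Y y) (h := fun y => -ρ y)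
    hcpt hη.1 hη.2 hK hM h2 hb.continuousOn hh.continuous
    (fun y hy => (hB₁ y hy).1.trans (le_max_left _ _)) (fun y hy => (hN y hy).1) hv₀ hG0 hL
    ?_ ?_ hx ht
  · intro y hy
    have h1 : spaceGrad Ω u y 0 = gradientWithin u₀ (closure Ω) y := by
      simp only [spaceGrad, gradientWithin]
      rw [fderivWithin_congr (fun z hz => hsol.initial z hz) (hsol.initial y hy)]
    rw [h1, gradientWithin, LinearIsometryEquiv.norm_map]
    exact ContinuousLinearMap.opNorm_le_bound _ hG0 (hG y hy).2
  · intro y hy s hs hv hmax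
    by_cases hyΩ : y ∈ Ω
    · have := interior_max_bound hΩ.isOpen h2 h3 hsol hc1 hf1
        (fun x hx z => ⟨(hC₁ x hx z).1.trans (le_max_left _ _),
          (hC₁ x hx z).2.1.trans (le_max_left _ _), (hC₁ x hx z).2.2⟩)
        (fun x hx z => ⟨(hC₂ x hx z).1.trans (le_max_right _ _),
          (hC₂ x hx z).2.1.trans (le_max_right _ _), (hC₂ x hx z).2.2⟩)
        hK hyΩ hs (hL _ hv) ((hB₁' y hyΩ).mono (le_max_left _ _)) (hN' y hyΩ) hmax
      linarith
    · have hyF : y ∈ frontier Ω := by rw [hΩ.isOpen.frontier_eq]; exact ⟨hy, hyΩ⟩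
      have := boundary_max_bound (δ := δ) hΩ h2 hsol hYν
        (hY.differentiable (by simp)).differentiableOn
        (fun ω => ((hB₂ y hy).2 ω).trans (by gcongr; exact le_max_right _ _)) (fun _ => rfl)
        (hb.differentiableOn (by simp)) ((hB₁ y hy).1.trans (le_max_left _ _))
        (fun ω => ((hB₁ y hy).2 ω).trans (by gcongr; exact le_max_left _ _))
        (hh.differentiable (by simp) y)
        (fun ν hν => by
          obtain ⟨m, hm, hm'⟩ := hρd y hyF ν hν
          exact ⟨m, hm, by rw [fderiv_fun_neg, hm']⟩)
        hK hyF hs (hL _ hv) hmax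
      rw [hKdef, div_mul_cancel₀ _ hδ.ne'] at this
      linarith

end

end CapillaryFlow

end

theorem proposition2p5 {n : ℕ} (hn : 2 ≤ n) (Ω : Set (EuclideanSpace ℝ (Fin n)))
    (hΩ : CapillaryFlow.IsBoundedDomainOfClass 3 Ω)
    (α : ℝ) (hα : α ∈ Set.Ioo (0 : ℝ) 1)
    (c f : EuclideanSpace ℝ (Fin n) → ℝ → ℝ)
    (hc : CapillaryFlow.ForcingAssumption α Ω c)
    (hf : CapillaryFlow.TransportAssumption α Ω f)
    (φ : EuclideanSpace ℝ (Fin n) → ℝ) (hφ : ContDiffOn ℝ 3 φ (closure Ω))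
    (q : ℝ) (hq : 0 < q)
    (u₀ : EuclideanSpace ℝ (Fin n) → ℝ)
    (hu₀ : CapillaryFlow.IsOfClassHolder 2 α (closure Ω) u₀)
    (T : ℝ) (hT : 0 < T) :
    ∃ R : ℝ, 1 < R ∧
      ∀ η ∈ Set.Ioc (0 : ℝ) 1, ∀ σ ∈ Set.Ioo (0 : ℝ) 1,
        ∀ u : EuclideanSpace ℝ (Fin n) → ℝ → ℝ,
          CapillaryFlow.IsParabolicC2 σ Ω T u →
          CapillaryFlow.IsParabolicC3Interior σ Ω T u →
          CapillaryFlow.IsSolution η q Ω T c f φ u₀ u →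
          ∀ x ∈ closure Ω, ∀ t ∈ Set.Icc (0 : ℝ) T,
            ‖CapillaryFlow.spaceGrad Ω u x t‖ ≤ R := by
  obtain ⟨R, hR⟩ := CapillaryFlow.exists_gradient_bound hΩ hc hf hφ hq hu₀.1 (T := T)
  refine ⟨max R 2, by simp, fun η hη σ _ u h2 h3 hsol x hx t ht => ?_⟩
  refine le_trans ?_ (le_max_left _ _)
  have hcont : ContinuousOn (fun s => ‖CapillaryFlow.spaceGrad Ω u x s‖) (Icc 0 T) :=
    (h2.continuousOn_grad.comp (Continuous.prodMk_right x).continuousOn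
      fun s hs => ⟨hx, hs⟩).norm
  -- The final time T is reached by continuity of Du, because the estimate was obtained on [0, T).
  rw [← closure_Ico hT.ne] at ht hcont
  exact le_on_closure (fun s hs => hR η hη σ u h2 h3 hsol x hx s hs) hcont
    continuousOn_const ht
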